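/- \textbf{Problem.} Let $n,m\ge 1$, let $\|\cdot\|$ be the Euclidean norm, and consider $$\min_{x\in\mathbb R^n}\ f_1(x)+\tfrac1m\sum_{i=1}^m f_2(x,y_i(x)),\qquad y_i(x)=\operatorname*{arg\,min}_{y\in Y_i(x)}h_i(x,y),$$ where $f_1(x)=\mathbb E[\tilde f_1(x,\xi)]$, $h_i(x,y)=\mathbb E[\tilde h_i(x,y,\zeta_i)]$ and $Y_i(x)\subseteq\mathbb R^n$ is nonempty (all sample gradients and projections being measurable). For $\eta>0$ let $f_2^\eta(x)=\frac1m\sum_{i}\mathbb E_u[f_2(x+\eta u,y_i(x+\eta u))]$ with $u$ uniform on the closed unit ball, and $f^\eta=f_1+f_2^\eta$. A continuously differentiable $g$ is called $L$-smooth if $g(y)\le g(x)+\nabla g(x)^\top(y-x)+\frac L2\|y-x\|^2$, and $\mu$-strongly convex if $g(y)\ge g(x)+\nabla g(x)^\top(y-x)+\frac\mu2\|y-x\|^2$, for all $x,y$. \textbf{Assumption.} For all $i$, $x$ and $y$: (i) $f_2(\cdot,y_i(\cdot))$ is $L_0^{\rm imp}$-Lipschitz, $f_2(\cdot,y)$ is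 $L_{0,x}^{f_2}$-Lipschitz, $f_2(x,\cdot)$ is $L_{0,y}^{f_2}$-Lipschitz. (ii) $h_i(x,\cdot)$ is $L_{1,y}^{h_i}$-smooth and $\mu_{h_i}$-strongly convex with $\mu_{h_i}>0$; $\nabla_yh_i(\cdot,y)$ is $L_{0,x}^{\nabla h_i}$-Lipschitz; $\mathbb E[\nabla_y\tilde h_i(x,y,\zeta_i)]=\nabla_yh_i(x,y)$ and $\mathbb E\|\nabla_yh_i(x,y)-\nabla_y\tilde h_i(x,y,\zeta_i)\|^2\le\sigma_i^2$. (iii) $f_1$ is $L_1^{f_1}$-smooth, $\mathbb E[\nabla\tilde f_1(x,\xi)]=\nabla f_1(x)$ and $\mathbb E\|\nabla\tilde f_1(x,\xi)-\nabla f_1(x)\|^2\le\sigma^2$. (iv) $Y_i(x)$ is closed and convex. Moreover, $f^\eta$ is bounded below. \textbf{Method (ZO-HFL).} Start from a random $\hat x_0$. In round $r=0,1,\dots$, directions $v_{i,r}$ ($i=1,\dots,m$) are drawn, each uniform on the unit sphere and independent of the history $\mathcal F_r$ of the method before round $r$. For each client $i$ and each sign $\pm$, set $x=\hat x_r\pm\eta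 v_{i,r}$, choose an initial point $y_{i,0}^{r,\pm}$, and run $H_{i,r}\ge0$ projected stochastic gradient steps $$y_{i,t+1}^{r,\pm}=\Pi_{Y_i(x)}\big[y_{i,t}^{r,\pm}-\tilde\gamma_{i,t}\nabla_y\tilde h_i(x,y_{i,t}^{r,\pm},\zeta_{i,t}^{r,\pm})\big],$$ where $\zeta_{i,t}^{r,\pm}$ is a sample of $\zeta_i$ independent of the history of this local iteration (which contains $\mathcal F_r$, all $v_{j,r}$, the initial point and the earlier local samples); denote the output by $y_{\varepsilon_{i,r}}^\pm$. Then $$\hat x_{r+1}=\hat x_r-\gamma_r\Big(\nabla\tilde f_1(\hat x_r,\xi_r)+\tfrac1m\sum_{i=1}^m\tfrac n{2\eta}\big(f_2(\hat x_r+\eta v_{i,r},y_{\varepsilon_{i,r}}^+)-f_2(\hat x_r-\eta v_{i,r},y_{\varepsilon_{i,r}}^-)\big)v_{i,r}\Big),$$ where $\xi_r$ is a sample of $\xi$ independent of $\mathcal F_r$. The history $\mathcal F_0$ is generated by $\hat x_0$, and $\mathcal F_{r+1}$ by $\mathcal F_r$, all local histories of round $r$, and $\xi_r$. Let $\varepsilon_{i,r}\ge0$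 be numbers such that $\mathbb E\|y_{\varepsilon_{i,r}}^\pm-y_i(\hat x_r\pm\eta v_{i,r})\|^2\le\varepsilon_{i,r}$ for both signs. \textbf{Theorem.} Let $\gamma_r\ge0$, $\gamma_r\le\dfrac{\eta}{4(\eta L_1^{f_1}+L_0^{\rm imp}\sqrt n)}$ for all $r$ (no condition if the denominator is $0$), $\sum_r\gamma_r=\infty$, $\sum_r\gamma_r^2<\infty$, and $\sum_r\gamma_r\frac1m\sum_{i=1}^m\varepsilon_{i,r}<\infty$. Then $f^\eta$ is differentiable and $$\liminf_{r\to\infty}\|\nabla f^\eta(\hat x_r)\|=0\quad\text{almost surely.}$$ -/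

import Mathlib

open MeasureTheory ProbabilityTheory Filter
open scoped NNReal ENNReal

noncomputable section

namespace ZOHFL

universe u v w

/-- The space `ℝⁿ` with the Euclidean norm. -/
abbrev Vec (n : ℕ) : Type := EuclideanSpace ℝ (Fin n)

/-- A point of `argmin_{y ∈ S} g y` (an arbitrary vector if there is no minimizer). -/
def argminOn {n : ℕ} (g : Vec n → ℝ) (S : Set (Vec n)) : Vec n :=
  Classical.epsilon fun y => y ∈ S ∧ IsMinOn g S y

/-- The Euclidean projection `Π_C[z]`: the point of `C` nearest to `z`. -/
def proj {n : ℕ} (C : Set (Vec n)) (z : Vec n) : Vec n :=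
  argminOn (fun p => ‖z - p‖) C

/-- The uniform distribution on the unit sphere of `ℝⁿ` (normalized surface measure). -/
def sphereUniform (n : ℕ) : Measure (Metric.sphere (0 : Vec n) 1) :=
  ((volume : Measure (Vec n)).toSphere Set.univ)⁻¹ • (volume : Measure (Vec n)).toSphere

/-- Spherical smoothing `x ↦ E[g (x + η u)]`, with `u` uniform on the unit ball. -/
def ballSmooth {n : ℕ} (η : ℝ) (g : Vec n → ℝ) (x : Vec n) : ℝ :=
  ⨍ u in Metric.closedBall (0 : Vec n) 1, g (x + η • u)

/-- `L`-smoothness of a continuously differentiable function on `ℝⁿ` (descent inequality). -/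
def IsLSmooth {n : ℕ} (L : ℝ) (g : Vec n → ℝ) : Prop :=
  ContDiff ℝ 1 g ∧
    ∀ x y, g y ≤ g x + inner ℝ (gradient g x) (y - x) + L / 2 * ‖y - x‖ ^ 2

/-- `μ`-strong convexity of a continuously differentiable function on `ℝⁿ`. -/
def IsStronglyConvex {n : ℕ} (μ : ℝ) (g : Vec n → ℝ) : Prop :=
  ContDiff ℝ 1 g ∧
    ∀ x y, g y ≥ g x + inner ℝ (gradient g x) (y - x) + μ / 2 * ‖y - x‖ ^ 2

/-- Data of the hierarchical federated problem with `m` clients in dimension `n`: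
`D` is the server's sample space, `Z i` the sample space of client `i`. -/
structure Problem (n m : ℕ) (D : Type u) [MeasurableSpace D]
    (Z : Fin m → Type v) [∀ i, MeasurableSpace (Z i)] where
  /-- the law of the server's sample `ξ` -/
  serverLaw : Measure D
  /-- the law of the sample `ζ_i` of client `i` -/
  clientLaw : ∀ i, Measure (Z i)
  /-- the server's stochastic loss `f̃₁(x, ξ)` -/
  f₁s : Vec n → D → ℝ
  /-- the penalty `f₂(x, y)` -/
  f₂ : Vec n → Vec n → ℝ
  /-- the stochastic loss `h̃_i(x, y, ζ)` of client `i` -/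
  hs : ∀ i, Vec n → Vec n → Z i → ℝ
  /-- the local constraint set `Y_i(x)` -/
  Y : Fin m → Vec n → Set (Vec n)

namespace Problem

variable {n m : ℕ} {D : Type u} [MeasurableSpace D] {Z : Fin m → Type v}
  [∀ i, MeasurableSpace (Z i)] (p : Problem n m D Z)

/-- `f₁(x) = E[f̃₁(x, ξ)]`. -/
def f₁ (x : Vec n) : ℝ := ∫ d, p.f₁s x d ∂p.serverLaw

/-- `∇ₓ f̃₁(x, ξ)`. -/
def gradf₁s (x : Vec n) (d : D) : Vec n := gradient (fun z => p.f₁s z d) x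

/-- `h_i(x, y) = E[h̃_i(x, y, ζ_i)]`. -/
def h (i : Fin m) (x y : Vec n) : ℝ := ∫ z, p.hs i x y z ∂p.clientLaw i

/-- `∇_y h̃_i(x, y, ζ)`. -/
def gradhs (i : Fin m) (x y : Vec n) (z : Z i) : Vec n := gradient (fun y' => p.hs i x y' z) y

/-- The lower-level solution `y_i(x) = argmin_{y ∈ Y_i(x)} h_i(x, y)`. -/
def ySol (i : Fin m) (x : Vec n) : Vec n := argminOn (p.h i x) (p.Y i x)

/-- The implicit function `x ↦ f₂(x, y_i(x))` of client `i`. -/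
def f₂imp (i : Fin m) (x : Vec n) : ℝ := p.f₂ x (p.ySol i x)

/-- `f₂^η(x) = (1/m) ∑ᵢ E[f₂(x + ηu, y_i(x + ηu))]`, with `u` uniform on the unit ball. -/
def f₂η (η : ℝ) (x : Vec n) : ℝ := (1 / (m : ℝ)) * ∑ i, ballSmooth η (p.f₂imp i) x

/-- The smoothed global objective `f^η = f₁ + f₂^η`. -/
def fη (η : ℝ) (x : Vec n) : ℝ := p.f₁ x + p.f₂η η x

/-- What is needed for the objects of the problem to make sense: sample laws are probability
measures, the losses are integrable and have sample gradients almost surely, the constraint sets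
are nonempty, and the sample gradients and projections that the method evaluates are measurable. -/
structure WellPosed : Prop where
  prob_server : IsProbabilityMeasure p.serverLaw
  prob_client : ∀ i, IsProbabilityMeasure (p.clientLaw i)
  integrable_f₁s : ∀ x, Integrable (p.f₁s x) p.serverLaw
  integrable_hs : ∀ i x y, Integrable (p.hs i x y) (p.clientLaw i)
  diff_f₁s : ∀ x, ∀ᵐ d ∂p.serverLaw, DifferentiableAt ℝ (fun z => p.f₁s z d) x
  diff_hs : ∀ i x y, ∀ᵐ z ∂p.clientLaw i, DifferentiableAt ℝ (fun y' => p.hs i x y' z) y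
  measurable_gradf₁s : Measurable fun q : Vec n × D => p.gradf₁s q.1 q.2
  measurable_gradhs : ∀ i, Measurable fun q : Vec n × Vec n × Z i => p.gradhs i q.1 q.2.1 q.2.2
  nonempty_Y : ∀ i x, (p.Y i x).Nonempty
  measurable_proj : ∀ i, Measurable fun q : Vec n × Vec n => proj (p.Y i q.1) q.2

end Problem

/-- The constants of the main assumption. -/
structure Constants (m : ℕ) where
  /-- Lipschitz constant of the implicit functions -/
  L₀imp : ℝ≥0
  /-- Lipschitz constant of `f₂(·, y)` -/
  L₀x : ℝ≥0
  /-- Lipschitz constant of `f₂(x, ·)` -/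
  L₀y : ℝ≥0
  /-- smoothness constant of `f₁` -/
  L₁f₁ : ℝ≥0
  /-- noise level of the server's sample gradients -/
  σ : ℝ≥0
  /-- smoothness constant of `h_i(x, ·)` -/
  L₁h : Fin m → ℝ≥0
  /-- strong convexity constant of `h_i(x, ·)` -/
  μh : Fin m → ℝ≥0
  /-- Lipschitz constant of `∇_y h_i(·, y)` -/
  L₀gradh : Fin m → ℝ≥0
  /-- noise level of the sample gradients of client `i` -/
  σh : Fin m → ℝ≥0

/-- The main assumption on the problem. -/
structure MainAssumption {n m : ℕ} {D : Type u} [MeasurableSpace D] {Z : Fin m → Type v}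
    [∀ i, MeasurableSpace (Z i)] (p : Problem n m D Z) (c : Constants m) : Prop where
  lip_imp : ∀ i, LipschitzWith c.L₀imp (p.f₂imp i)
  lip_x : ∀ y, LipschitzWith c.L₀x fun x => p.f₂ x y
  lip_y : ∀ x, LipschitzWith c.L₀y (p.f₂ x)
  smooth_h : ∀ i x, IsLSmooth (c.L₁h i) (p.h i x)
  μh_pos : ∀ i, 0 < c.μh i
  strong_h : ∀ i x, IsStronglyConvex (c.μh i) (p.h i x)
  lip_gradh : ∀ i y, LipschitzWith (c.L₀gradh i) fun x => gradient (p.h i x) y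
  integrable_gradhs : ∀ i x y, Integrable (p.gradhs i x y) (p.clientLaw i)
  unbiased_h : ∀ i x y, ∫ z, p.gradhs i x y z ∂p.clientLaw i = gradient (p.h i x) y
  var_h : ∀ i x y,
    ∫⁻ z, ‖gradient (p.h i x) y - p.gradhs i x y z‖ₑ ^ 2 ∂p.clientLaw i ≤ (c.σh i : ℝ≥0∞) ^ 2
  smooth_f₁ : IsLSmooth c.L₁f₁ p.f₁
  integrable_gradf₁s : ∀ x, Integrable (p.gradf₁s x) p.serverLaw
  unbiased_f₁ : ∀ x, ∫ d, p.gradf₁s x d ∂p.serverLaw = gradient p.f₁ x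
  var_f₁ : ∀ x, ∫⁻ d, ‖p.gradf₁s x d - gradient p.f₁ x‖ₑ ^ 2 ∂p.serverLaw ≤ (c.σ : ℝ≥0∞) ^ 2
  closed_Y : ∀ i x, IsClosed (p.Y i x)
  convex_Y : ∀ i x, Convex ℝ (p.Y i x)

/-- The sign of the two evaluation points `x̂_r ± η v_{i,r}` (`true` is `+`, `false` is `-`). -/
def sgn (b : Bool) : ℝ := if b then 1 else -1

/-- Parameters, initial points and random samples of a run of the method. -/
structure Run (n m : ℕ) (Ω : Type w) (D : Type u) (Z : Fin m → Type v) where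
  /-- smoothing parameter -/
  η : ℝ
  /-- server steps `γ_r` -/
  γ : ℕ → ℝ
  /-- local steps `γ̃_{i,t}` -/
  γloc : Fin m → ℕ → ℝ
  /-- numbers `H_{i,r}` of local steps -/
  H : Fin m → ℕ → ℕ
  /-- initial global model `x̂₀` -/
  x₀ : Ω → Vec n
  /-- directions `v_{i,r}` -/
  v : Fin m → ℕ → Ω → Metric.sphere (0 : Vec n) 1
  /-- server samples `ξ_r` -/
  ξ : ℕ → Ω → D
  /-- initial points `y_{i,0}^{r,±}` of the local iterations -/
  y₀ : Fin m → ℕ → Bool → Ω → Vec n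
  /-- client samples `ζ_{i,t}^{r,±}` -/
  ζ : ∀ i, ℕ → Bool → ℕ → Ω → Z i

/-- The local iterates of client `i` (projected stochastic gradient steps) for the input `x`, the
initial point `y₀`, the steps `step t` and the samples `z t`. -/
def localIter {n m : ℕ} {D : Type u} [MeasurableSpace D] {Z : Fin m → Type v}
    [∀ i, MeasurableSpace (Z i)] (p : Problem n m D Z) (i : Fin m) (step : ℕ → ℝ)
    (x y₀ : Vec n) (z : ℕ → Z i) : ℕ → Vec n
  | 0 => y₀
  | t + 1 =>
    let y := localIter p i step x y₀ z t
    proj (p.Y i x) (y - step t • p.gradhs i x y (z t))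

namespace Run

variable {n m : ℕ} {Ω : Type w} [MeasurableSpace Ω] {D : Type u} [MeasurableSpace D]
  {Z : Fin m → Type v} [∀ i, MeasurableSpace (Z i)]
  (a : Run n m Ω D Z) (p : Problem n m D Z)

/-- `x ± η v_{i,r}`. -/
def evalPt (r : ℕ) (ω : Ω) (x : Vec n) (i : Fin m) (b : Bool) : Vec n :=
  x + (sgn b * a.η) • (a.v i r ω : Vec n)

/-- The output `y_{ε_{i,r}}(x ± η v_{i,r})` of the local iterations of client `i` at round `r`. -/
def yOut (r : ℕ) (ω : Ω) (x : Vec n) (i : Fin m) (b : Bool) : Vec n :=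
  localIter p i (a.γloc i) (a.evalPt r ω x i b) (a.y₀ i r b ω) (fun t => a.ζ i r b t ω) (a.H i r)

/-- The inexact zeroth-order gradient
`(n / 2η) (f₂(x + ηv, y_ε⁺) - f₂(x - ηv, y_ε⁻)) v` of client `i` at round `r`. -/
def gClient (r : ℕ) (ω : Ω) (x : Vec n) (i : Fin m) : Vec n :=
  ((n : ℝ) / (2 * a.η) *
    (p.f₂ (a.evalPt r ω x i true) (a.yOut p r ω x i true) -
      p.f₂ (a.evalPt r ω x i false) (a.yOut p r ω x i false))) • (a.v i r ω : Vec n)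

/-- The global iterates `x̂_r`. -/
def xhat : ℕ → Ω → Vec n
  | 0, ω => a.x₀ ω
  | r + 1, ω =>
    let x := xhat r ω
    x - a.γ r • (p.gradf₁s x (a.ξ r ω) + (1 / (m : ℝ)) • ∑ i, a.gClient p r ω x i)

/-- The history of the local iterations of client `i` after `t` steps at round `r`, given the
history `F` of the global iteration before round `r`. -/
@[reducible] def clientHistory (F : MeasurableSpace Ω) (i : Fin m) (r : ℕ) (b : Bool) : ℕ → MeasurableSpace Ω
  | 0 => F ⊔ (⨆ j, MeasurableSpace.comap (a.v j r) inferInstance) ⊔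
      MeasurableSpace.comap (a.y₀ i r b) inferInstance
  | t + 1 => clientHistory F i r b t ⊔ MeasurableSpace.comap (a.ζ i r b t) inferInstance

/-- The history of the global iteration before round `r`. -/
@[reducible] def history : ℕ → MeasurableSpace Ω
  | 0 => MeasurableSpace.comap a.x₀ inferInstance
  | r + 1 => history r ⊔ (⨆ i, ⨆ b, a.clientHistory (history r) i r b (a.H i r)) ⊔
      MeasurableSpace.comap (a.ξ r) inferInstance

/-- The probabilistic rules of the method: all initial points and samples are random variables;
`v_{i,r}` is uniform on the sphere and independent of the history before round `r`; `ξ_r` is drawn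
from the server's law independently of that history; `ζ_{i,t}^{r,±}` is drawn from the law of
client `i` independently of the history of the local iterations. -/
structure IsAdmissible (P : Measure Ω) : Prop where
  measurable_x₀ : Measurable a.x₀
  measurable_v : ∀ i r, Measurable (a.v i r)
  measurable_ξ : ∀ r, Measurable (a.ξ r)
  measurable_y₀ : ∀ i r b, Measurable (a.y₀ i r b)
  measurable_ζ : ∀ i r b t, Measurable (a.ζ i r b t)
  law_v : ∀ i r, P.map (a.v i r) = sphereUniform n
  law_ξ : ∀ r, P.map (a.ξ r) = p.serverLaw
  law_ζ : ∀ i r b, ∀ t < a.H i r, P.map (a.ζ i r b t) = p.clientLaw i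
  indep_v : ∀ i r, Indep (MeasurableSpace.comap (a.v i r) inferInstance) (a.history r) P
  indep_ξ : ∀ r, Indep (MeasurableSpace.comap (a.ξ r) inferInstance) (a.history r) P
  indep_ζ : ∀ i r b, ∀ t < a.H i r,
    Indep (MeasurableSpace.comap (a.ζ i r b t) inferInstance)
      (a.clientHistory (a.history r) i r b t) P

/-- `ε_{i,r}` bounds the mean squared errors of the outputs of the local iterations:
`E‖y_{ε_{i,r}}(x̂_r ± ηv_{i,r}) - y_i(x̂_r ± ηv_{i,r})‖² ≤ ε_{i,r}`. -/
def HasInexactness (P : Measure Ω) (ε : Fin m → ℕ → ℝ≥0) : Prop :=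
  ∀ i r b,
    ∫⁻ ω, ‖a.yOut p r ω (a.xhat p r ω) i b -
      p.ySol i (a.evalPt r ω (a.xhat p r ω) i b)‖ₑ ^ 2 ∂P ≤ ε i r

end Run

end ZOHFL

end

/-! The method is stochastic gradient descent on `f^η` with a biased oracle. Smoothing over the ball
makes a Lipschitz function differentiable, and the divergence theorem turns its gradient into a
sphere integral, which is the mean of the two-point estimator (`hasGradientAt_ballSmooth`). The
divergence theorem for Lipschitz functions comes from integrating by parts against a radial cutoff
and letting the width of its transition shell tend to zero.

Since the estimator is Lipschitz in its base point, `f^η` has a quadratic upper bound with some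
constant `K` (`fη_le_quadratic`). Each server step is the exact gradient plus three perturbations:
server noise and direction noise, both centred given the past with bounded second moments, and an
error from the inexact lower-level solutions. The error is not centred, but its mean square is at
most a constant times the client average of the `ε i r`. Once `16 K γ ≤ 1`, the quadratic bound and
Young's inequality yield, in mean, a decrease of `γ/2 ‖∇f^η‖²` up to a remainder of order `γ²` plus
`γ` times that average (`expected_descent`). The remainders are summable and `f^η` is bounded below,
so `∑ γ_r ‖∇f^η(x̂_r)‖²` is almost surely finite. As `∑ γ_r` diverges, the gradients cannot stay
away from zero.

Two points need care. The condition `16 K γ ≤ 1` is only needed eventually, and holds because square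
summability forces `γ_r → 0`. Moreover `f^η(x̂_r)` need not be integrable, as no moment of the
starting point is given. The argument is therefore run on events of the history before a late round
`R` on which `f^η(x̂_R)` is bounded; countably many of them cover the whole space. Integrals over
such events take the place of conditional expectations. -/

section Polar

open Metric Set Topology

/-! ### Radial cutoffs and thin shells -/

section Shell

variable {E : Type*} [NormedAddCommGroup E]

/-- The part of the unit ball at distance less than `δ` from the unit sphere. -/
noncomputable def outerShell (E : Type*) [NormedAddCommGroup E] (δ : ℝ) : Set E :=
  ball 0 1 \ closedBall 0 (1 - δ)

theorem measurableSet_outerShell [MeasurableSpace E] [BorelSpace E] (δ : ℝ) :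
    MeasurableSet (outerShell E δ) :=
  measurableSet_ball.diff measurableSet_closedBall

theorem mem_outerShell {δ : ℝ} {u : E} : u ∈ outerShell E δ ↔ 1 - δ < ‖u‖ ∧ ‖u‖ < 1 := by
  simp [outerShell, and_comm]

/-- The radial cutoff equal to `1` on the ball of radius `1 - δ`, to `0` off the unit ball, and
affine in the norm in between. -/
noncomputable def radialCutoff (δ : ℝ) (u : E) : ℝ := max 0 (min 1 (δ⁻¹ * (1 - ‖u‖)))

theorem lipschitzWith_radialCutoff {δ : ℝ} (hδ : 0 < δ) :
    LipschitzWith ⟨δ⁻¹, by positivity⟩ (radialCutoff δ : E → ℝ) := by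
  have : LipschitzWith ⟨δ⁻¹, by positivity⟩ fun u : E => δ⁻¹ * (1 - ‖u‖) :=
    LipschitzWith.of_dist_le_mul fun x y => by
      rw [Real.dist_eq, ← mul_sub, abs_mul, abs_of_pos (inv_pos.2 hδ), dist_eq_norm]
      have := abs_norm_sub_norm_le y x
      rw [norm_sub_rev, show ‖y‖ - ‖x‖ = 1 - ‖x‖ - (1 - ‖y‖) by ring] at this
      exact mul_le_mul_of_nonneg_left this (inv_pos.2 hδ).le
  exact (this.const_min 1).const_max 0

theorem hasCompactSupport_radialCutoff [ProperSpace E] {δ : ℝ} (hδ : 0 < δ) :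
    HasCompactSupport (radialCutoff δ : E → ℝ) := by
  refine HasCompactSupport.of_support_subset_isCompact (isCompact_closedBall (0 : E) 1)
    fun u hu => ?_
  by_contra h
  simp only [mem_closedBall_zero_iff, not_le] at h
  refine hu (max_eq_left ((min_le_right _ _).trans ?_))
  exact mul_nonpos_of_nonneg_of_nonpos (inv_pos.2 hδ).le (by linarith)

theorem radialCutoff_eq_one {δ : ℝ} (hδ : 0 < δ) {u : E} (hu : ‖u‖ ≤ 1 - δ) :
    radialCutoff δ u = 1 := by
  rw [radialCutoff, min_eq_left, max_eq_right zero_le_one]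
  rw [← div_eq_inv_mul, le_div_iff₀ hδ]
  linarith

theorem radialCutoff_eq_zero {δ : ℝ} (hδ : 0 < δ) {u : E} (hu : 1 ≤ ‖u‖) :
    radialCutoff δ u = 0 :=
  max_eq_left ((min_le_right _ _).trans
    (mul_nonpos_of_nonneg_of_nonpos (inv_pos.2 hδ).le (by linarith)))

theorem radialCutoff_mem_Icc (δ : ℝ) (u : E) : radialCutoff δ u ∈ Icc (0 : ℝ) 1 :=
  ⟨le_max_left _ _, max_le zero_le_one (min_le_left _ _)⟩

/-- The cutoff is constant on each side of the shell and affine in the norm inside it; its kinks lie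
on the two excluded spheres, which are null sets. The direction is `-w` because that is what
integration by parts produces, and `δ < 1` keeps the shell away from the origin, where the norm is
not differentiable. -/
theorem lineDeriv_radialCutoff [InnerProductSpace ℝ E] {δ : ℝ} (hδ : 0 < δ) (hδ1 : δ < 1) (w : E) {u : E}
    (h1 : ‖u‖ ≠ 1) (h2 : ‖u‖ ≠ 1 - δ) :
    lineDeriv ℝ (radialCutoff δ) u (-w) =
      (outerShell E δ).indicator (fun u => δ⁻¹ * inner ℝ (‖u‖⁻¹ • u) w) u := by
  have hc : Continuous fun u : E => ‖u‖ := continuous_norm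
  rcases lt_or_gt_of_ne h1 with h1 | h1
  · rcases lt_or_gt_of_ne h2 with h2 | h2
    · rw [indicator_of_notMem (fun h => (mem_outerShell.1 h).1.not_ge h2.le)]
      have : radialCutoff δ =ᶠ[𝓝 u] fun _ : E => (1 : ℝ) := by
        filter_upwards [hc.continuousAt.eventually_lt continuousAt_const h2] with x hx
        exact radialCutoff_eq_one hδ hx.le
      rw [this.lineDeriv_eq]
      simp [lineDeriv]
    · rw [indicator_of_mem (mem_outerShell.2 ⟨h2, h1⟩)]
      have hu : u ≠ 0 := by
        rintro rfl
        simp at h2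
        linarith
      have : radialCutoff δ =ᶠ[𝓝 u] fun x : E => δ⁻¹ * (1 - ‖x‖) := by
        filter_upwards [hc.continuousAt.eventually_lt continuousAt_const h1,
          continuousAt_const.eventually_lt hc.continuousAt h2] with x hx hx'
        rw [radialCutoff, min_eq_right, max_eq_right]
        · exact mul_nonneg (inv_pos.2 hδ).le (by linarith)
        · rw [← div_eq_inv_mul, div_le_iff₀ hδ]
          linarith
      rw [this.lineDeriv_eq]
      have hn : HasFDerivAt (fun x : E => ‖x‖) (‖u‖⁻¹ • innerSL ℝ u) u := by
        have h := ((hasStrictFDerivAt_norm_sq u).hasFDerivAt).sqrt (by simpa using hu)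
        simp only [Real.sqrt_sq (norm_nonneg _)] at h
        convert h using 1
        ext x
        simp
        field_simp
      have h3 := ((hn.const_sub 1).const_mul δ⁻¹).hasLineDerivAt (-w)
      rw [h3.lineDeriv]
      simp [inner_smul_left]
  · rw [indicator_of_notMem (fun h => (mem_outerShell.1 h).2.not_ge h1.le)]
    have : radialCutoff δ =ᶠ[𝓝 u] fun _ : E => (0 : ℝ) := by
      filter_upwards [continuousAt_const.eventually_lt hc.continuousAt h1] with x hx
      exact radialCutoff_eq_zero hδ hx.le
    rw [this.lineDeriv_eq]
    simp [lineDeriv]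

end Shell

/-! ### Polar coordinates and the divergence theorem on the unit ball -/

variable {E : Type*} [NormedAddCommGroup E] [InnerProductSpace ℝ E] [FiniteDimensional ℝ E]
  [MeasurableSpace E] [BorelSpace E] (μ : Measure E) [μ.IsAddHaarMeasure]

theorem integral_norm_mul_direction [Nontrivial E] (ρ : ℝ → ℝ) (k : E → ℝ) :
    ∫ u, ρ ‖u‖ * k (‖u‖⁻¹ • u) ∂μ =
      (∫ v : sphere (0 : E) 1, k v ∂μ.toSphere) *
        ∫ s : Ioi (0 : ℝ), ρ s ∂(Measure.volumeIoiPow (Module.finrank ℝ E - 1)) := by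
  rw [← integral_prod_mul (fun v : sphere (0 : E) 1 => k v) (fun s : Ioi (0 : ℝ) => ρ s),
    ← μ.measurePreserving_homeomorphUnitSphereProd.integral_comp
      (Homeomorph.measurableEmbedding _),
    ← restrict_compl_singleton (μ := μ) 0,
    ← integral_subtype_comap (measurableSet_singleton _).compl
      fun u : E => ρ ‖u‖ * k (‖u‖⁻¹ • u)]
  simp [mul_comm]

theorem measureReal_outerShell [Nontrivial E] {δ : ℝ} (h0 : 0 ≤ δ) (h1 : δ ≤ 1) :
    μ.real (outerShell E δ) =
      (1 - (1 - δ) ^ Module.finrank ℝ E) * μ.real (ball (0 : E) 1) := by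
  rcases h0.eq_or_lt with rfl | h0
  · simp [outerShell, measureReal_def, sdiff_eq_empty.2 ball_subset_closedBall]
  rw [outerShell, measureReal_sdiff (closedBall_subset_ball (by linarith)) measurableSet_closedBall,
    Measure.addHaar_real_closedBall μ 0 (by linarith : (0 : ℝ) ≤ 1 - δ)]
  ring

/-- In polar coordinates both sides carry the same radial factor. Taking `k = 1` identifies that
factor through the volume of the shell, so it never has to be computed. -/
theorem setIntegral_outerShell_direction [Nontrivial E] (δ : ℝ) (k : E → ℝ) :
    (∫ u in outerShell E δ, k (‖u‖⁻¹ • u) ∂μ) * μ.toSphere.real univ =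
      (∫ v : sphere (0 : E) 1, k v ∂μ.toSphere) * μ.real (outerShell E δ) := by
  have key : ∀ k : E → ℝ, ∫ u in outerShell E δ, k (‖u‖⁻¹ • u) ∂μ =
      (∫ v : sphere (0 : E) 1, k v ∂μ.toSphere) *
        ∫ s : Ioi (0 : ℝ), (Ioo (1 - δ) 1).indicator (fun _ => (1 : ℝ)) s
          ∂(Measure.volumeIoiPow (Module.finrank ℝ E - 1)) := by
    intro k
    rw [← integral_norm_mul_direction, ← integral_indicator (measurableSet_outerShell δ)]
    congr 1 with u
    by_cases hu : u ∈ outerShell E δ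
    · rw [indicator_of_mem hu, indicator_of_mem (by simpa [mem_outerShell] using hu), one_mul]
    · rw [indicator_of_notMem hu, indicator_of_notMem (by simpa [mem_outerShell] using hu),
        zero_mul]
  have h1 := key fun _ => 1
  simp only [integral_const, smul_eq_mul, mul_one, measureReal_restrict_apply_univ] at h1
  rw [key k, h1]
  ring

/-- The divergence theorem on the unit ball for a Lipschitz function. -/
theorem LipschitzWith.setIntegral_lineDeriv_closedBall [Nontrivial E] {C : ℝ≥0} {F : E → ℝ}
    (hF : LipschitzWith C F) (w : E) :
    ∫ u in closedBall (0 : E) 1, lineDeriv ℝ F u w ∂μ =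
      ∫ v : sphere (0 : E) 1, F v * inner ℝ (v : E) w ∂μ.toSphere := by
  set N := Module.finrank ℝ E
  have hN : 0 < N := Module.finrank_pos
  set V := μ.real (ball (0 : E) 1)
  have hV : 0 < V := ENNReal.toReal_pos (measure_ball_pos μ 0 one_pos).ne' measure_ball_lt_top.ne
  set S := ∫ v : sphere (0 : E) 1, F v * inner ℝ (v : E) w ∂μ.toSphere
  set I := ∫ u in closedBall (0 : E) 1, lineDeriv ℝ F u w ∂μ
  have hm : Measurable fun u => lineDeriv ℝ F u w := measurable_lineDeriv hF.continuous
  have hFm : Measurable F := hF.continuous.measurable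
  have hbd : ∀ u, ‖lineDeriv ℝ F u w‖ ≤ C * ‖w‖ := fun u =>
    norm_lineDeriv_le_of_lipschitz ℝ hF
  have hfin : ∀ δ, μ (outerShell E δ) ≠ ∞ := fun δ =>
    ((measure_mono sdiff_subset).trans_lt measure_ball_lt_top).ne
  -- One copy of `C ‖w‖` pays for replacing `F u` by its value at the radial projection `u / ‖u‖`,
  -- the other for replacing the indicator of the ball by the cutoff.
  have hest : ∀ δ, 0 < δ → δ < 1 →
      |I - S / (N * V) * (μ.real (outerShell E δ) / δ)| ≤
        2 * (C * ‖w‖) * μ.real (outerShell E δ) := by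
    intro δ hδ hδ1
    have hip := LipschitzWith.integral_lineDeriv_mul_eq (μ := μ) hF (lipschitzWith_radialCutoff hδ)
      (hasCompactSupport_radialCutoff hδ) w
    have hae : ∀ᵐ u : E ∂μ, ‖u‖ ≠ 1 ∧ ‖u‖ ≠ 1 - δ := by
      have h1 := Measure.addHaar_sphere μ (0 : E) 1
      have h2 := Measure.addHaar_sphere μ (0 : E) (1 - δ)
      filter_upwards [measure_eq_zero_iff_ae_notMem.1 h1, measure_eq_zero_iff_ae_notMem.1 h2]
        with u hu1 hu2
      simpa using And.intro hu1 hu2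
    have hR : ∫ u, lineDeriv ℝ (radialCutoff δ) u (-w) * F u ∂μ =
        ∫ u in outerShell E δ, δ⁻¹ * inner ℝ (‖u‖⁻¹ • u) w * F u ∂μ := by
      rw [← integral_indicator (measurableSet_outerShell δ)]
      refine integral_congr_ae ?_
      filter_upwards [hae] with u hu
      rw [lineDeriv_radialCutoff hδ hδ1 w hu.1 hu.2]
      by_cases h : u ∈ outerShell E δ <;> simp [h]
    have hiw : ∀ u : E, |inner ℝ (‖u‖⁻¹ • u) w| ≤ ‖w‖ := by
      intro u
      refine (abs_real_inner_le_norm _ _).trans ?_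
      rw [norm_smul, norm_inv, norm_norm]
      exact mul_le_of_le_one_left (norm_nonneg _) (inv_mul_le_one)
    have hSsh := setIntegral_outerShell_direction μ δ fun u => F u * inner ℝ u w
    rw [Measure.toSphere_real_apply_univ] at hSsh
    have hSsh' : S / (N * V) * (μ.real (outerShell E δ) / δ) =
        ∫ u in outerShell E δ, δ⁻¹ * inner ℝ (‖u‖⁻¹ • u) w * F (‖u‖⁻¹ • u) ∂μ := by
      have : ∀ u, δ⁻¹ * inner ℝ (‖u‖⁻¹ • u) w * F (‖u‖⁻¹ • u) =
        δ⁻¹ * (F (‖u‖⁻¹ • u) * inner ℝ (‖u‖⁻¹ • u) w) := fun u => by ring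
      simp_rw [this, integral_const_mul]
      rw [div_mul_div_comm, div_eq_iff (by positivity), ← hSsh]
      change _ = δ⁻¹ * _ * (N * V * δ)
      field_simp
      simp only [one_div]
      ring
    have hFb : ∃ K, ∀ u ∈ closedBall (0 : E) 1, ‖F u‖ ≤ K :=
      (isCompact_closedBall (0 : E) 1).exists_bound_of_continuousOn hF.continuous.continuousOn
    obtain ⟨K, hK⟩ := hFb
    have hdir : ∀ u : E, ‖u‖⁻¹ • u ∈ closedBall (0 : E) 1 := fun u => by
      rw [mem_closedBall_zero_iff, norm_smul, norm_inv, norm_norm]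
      exact inv_mul_le_one
    have hint : ∀ f : E → E, Measurable f → (∀ u ∈ outerShell E δ, f u ∈ closedBall (0 : E) 1) →
        IntegrableOn (fun u => δ⁻¹ * inner ℝ (‖u‖⁻¹ • u) w * F (f u)) (outerShell E δ) μ := by
      intro f hf hfb
      refine IntegrableOn.of_bound (hfin δ).lt_top (by
        refine Measurable.aestronglyMeasurable ?_
        exact (((measurable_norm.inv.smul measurable_id).inner measurable_const).const_mul _).mul
          (hFm.comp hf)) (δ⁻¹ * ‖w‖ * K) ?_
      refine (ae_restrict_iff' (measurableSet_outerShell δ)).2 (ae_of_all _ fun u hu => ?_)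
      rw [norm_mul, norm_mul, Real.norm_of_nonneg (inv_pos.2 hδ).le]
      gcongr
      · exact hiw u
      · exact hK _ (hfb u hu)
    have e1 : |(∫ u, lineDeriv ℝ (radialCutoff δ) u (-w) * F u ∂μ) -
        S / (N * V) * (μ.real (outerShell E δ) / δ)| ≤ C * ‖w‖ * μ.real (outerShell E δ) := by
      rw [hR, hSsh', ← integral_sub
        (hint (fun u => u) measurable_id fun u hu => by
          simpa using (mem_outerShell.1 hu).2.le)
        (hint (fun u => ‖u‖⁻¹ • u) (measurable_norm.inv.smul measurable_id) fun u _ => hdir u)]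
      rw [← Real.norm_eq_abs]
      refine norm_setIntegral_le_of_norm_le_const (hfin δ).lt_top fun u hu => ?_
      obtain ⟨hu1, hu2⟩ := mem_outerShell.1 hu
      have hu0 : 0 < ‖u‖ := by linarith
      -- A point of the shell is within `δ` of its radial projection; this cancels the slope `δ⁻¹`
      -- of the cutoff.
      have hd : dist u (‖u‖⁻¹ • u) ≤ δ := by
        have : u - ‖u‖⁻¹ • u = (1 - ‖u‖⁻¹) • u := by rw [sub_smul, one_smul]
        have h : ‖u‖ - 1 = (1 - ‖u‖⁻¹) * ‖u‖ := by field_simp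
        have h' : ‖(1 - ‖u‖⁻¹) * ‖u‖‖ = |‖u‖ - 1| := by rw [h, Real.norm_eq_abs]
        rw [norm_mul, norm_norm] at h'
        rw [dist_eq_norm, this, norm_smul, h', abs_le]
        constructor <;> linarith
      rw [← mul_sub, norm_mul, norm_mul, Real.norm_of_nonneg (inv_pos.2 hδ).le, Real.norm_eq_abs,
        ← dist_eq_norm]
      calc δ⁻¹ * |inner ℝ (‖u‖⁻¹ • u) w| * dist (F u) (F (‖u‖⁻¹ • u))
          ≤ δ⁻¹ * ‖w‖ * (C * δ) := by
            gcongr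
            · exact hiw u
            · exact (hF.dist_le_mul _ _).trans (by gcongr)
        _ = C * ‖w‖ := by field_simp
    have e2 : |I - ∫ u, lineDeriv ℝ F u w * radialCutoff δ u ∂μ| ≤
        C * ‖w‖ * μ.real (outerShell E δ) := by
      have hI : I = ∫ u in ball (0 : E) 1, lineDeriv ℝ F u w ∂μ := by
        refine setIntegral_congr_set ?_
        exact (ae_eq_of_subset_of_measure_ge ball_subset_closedBall
          (Measure.addHaar_closedBall_eq_addHaar_ball μ 0 1).le measurableSet_ball.nullMeasurableSet
          measure_closedBall_lt_top.ne).symm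
      have hJ : ∫ u, lineDeriv ℝ F u w * radialCutoff δ u ∂μ =
          ∫ u in ball (0 : E) 1, lineDeriv ℝ F u w * radialCutoff δ u ∂μ := by
        refine (setIntegral_eq_integral_of_forall_compl_eq_zero fun u hu => ?_).symm
        rw [radialCutoff_eq_zero hδ (by simpa using hu), mul_zero]
      have hcm : Measurable (radialCutoff δ : E → ℝ) :=
        (lipschitzWith_radialCutoff hδ).continuous.measurable
      have i1 : IntegrableOn (fun u => lineDeriv ℝ F u w) (ball (0 : E) 1) μ :=
        IntegrableOn.of_bound measure_ball_lt_top hm.aestronglyMeasurable (C * ‖w‖)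
          (ae_of_all _ hbd)
      have hle : ∀ u : E, ‖radialCutoff δ u‖ ≤ 1 := fun u => by
        rw [Real.norm_of_nonneg (radialCutoff_mem_Icc δ u).1]
        exact (radialCutoff_mem_Icc δ u).2
      have i2 : IntegrableOn (fun u => lineDeriv ℝ F u w * radialCutoff δ u) (ball (0 : E) 1) μ := by
        refine IntegrableOn.of_bound measure_ball_lt_top (hm.mul hcm).aestronglyMeasurable
          (C * ‖w‖) (ae_of_all _ fun u => ?_)
        rw [norm_mul]
        exact (mul_le_of_le_one_right (norm_nonneg _) (hle u)).trans (hbd u)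
      rw [hI, hJ, ← integral_sub i1 i2]
      have : ∫ u in ball (0 : E) 1, (lineDeriv ℝ F u w - lineDeriv ℝ F u w * radialCutoff δ u) ∂μ
          = ∫ u in outerShell E δ, (lineDeriv ℝ F u w - lineDeriv ℝ F u w * radialCutoff δ u) ∂μ := by
        refine setIntegral_eq_of_subset_of_forall_sdiff_eq_zero measurableSet_ball sdiff_subset
          fun u hu => ?_
        have : ‖u‖ ≤ 1 - δ := by
          by_contra h
          exact hu.2 (mem_outerShell.2 ⟨not_le.1 h, by simpa using hu.1⟩)
        rw [radialCutoff_eq_one hδ this, mul_one, sub_self]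
      rw [this]
      rw [← Real.norm_eq_abs]
      refine norm_setIntegral_le_of_norm_le_const (hfin δ).lt_top fun u _ => ?_
      rw [show lineDeriv ℝ F u w - lineDeriv ℝ F u w * radialCutoff δ u =
        lineDeriv ℝ F u w * (1 - radialCutoff δ u) by ring, norm_mul]
      refine (mul_le_of_le_one_right (norm_nonneg _) ?_).trans (hbd u)
      rw [Real.norm_of_nonneg (by linarith [(radialCutoff_mem_Icc δ u).2])]
      linarith [(radialCutoff_mem_Icc δ u).1]
    rw [hip] at e2
    calc _ ≤ _ := abs_sub_le _ _ _
      _ ≤ _ := add_le_add e2 e1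
      _ = _ := by ring
  -- The derivative at `0` of the shell volume relative to the ball: it makes shell volume over `δ`
  -- tend to `N V`, the total surface measure.
  have hpow : Tendsto (fun δ : ℝ => (1 - (1 - δ) ^ N) / δ) (𝓝[>] 0) (𝓝 N) := by
    have hd : HasDerivAt (fun δ : ℝ => 1 - (1 - δ) ^ N) N 0 := by
      have := (((hasDerivAt_id (0 : ℝ)).const_sub 1).pow N).const_sub 1
      simpa using this
    have := hd.hasDerivWithinAt (s := Ioi 0)
    rw [hasDerivWithinAt_iff_tendsto_slope' (by simp)] at this
    refine this.congr fun δ => ?_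
    simp [slope_def_field]
  have hshell : Tendsto (fun δ : ℝ => μ.real (outerShell E δ)) (𝓝[>] 0) (𝓝 0) := by
    have : Tendsto (fun δ : ℝ => (1 - (1 - δ) ^ N) * V) (𝓝[>] 0) (𝓝 0) := by
      have : Continuous fun δ : ℝ => (1 - (1 - δ) ^ N) * V := by fun_prop
      simpa using (this.tendsto 0).mono_left nhdsWithin_le_nhds
    refine this.congr' ?_
    filter_upwards [Ioo_mem_nhdsGT (zero_lt_one' ℝ)] with δ hδ
    rw [measureReal_outerShell μ hδ.1.le hδ.2.le]
  have hquot : Tendsto (fun δ : ℝ => μ.real (outerShell E δ) / δ) (𝓝[>] 0) (𝓝 (N * V)) := by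
    refine (hpow.mul_const V).congr' ?_
    filter_upwards [Ioo_mem_nhdsGT (zero_lt_one' ℝ)] with δ hδ
    rw [measureReal_outerShell μ hδ.1.le hδ.2.le]
    ring
  have hlim := le_of_tendsto_of_tendsto
    (((hquot.const_mul (S / (N * V))).const_sub I).abs) (hshell.const_mul (2 * (C * ‖w‖)))
    (by filter_upwards [Ioo_mem_nhdsGT (zero_lt_one' ℝ)] with δ hδ using hest δ hδ.1 hδ.2)
  rw [mul_zero, div_mul_cancel₀ _ (by positivity)] at hlim
  exact sub_eq_zero.1 (abs_eq_zero.1 (le_antisymm hlim (abs_nonneg _)))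

end Polar

/-! ### Antipodal symmetry of sphere integrals -/

section Neg

open Metric Set

variable {E : Type*} [NormedAddCommGroup E] [InnerProductSpace ℝ E] [FiniteDimensional ℝ E]
  [MeasurableSpace E] [BorelSpace E] (μ : Measure E) [μ.IsAddHaarMeasure]

/-- The divergence theorem turns both sides into ball integrals of line derivatives. There the
reflection `u ↦ -u` preserves `μ` and the chain rule supplies the sign. -/
theorem LipschitzWith.integral_toSphere_neg_mul_inner [Nontrivial E] {C : ℝ≥0} {F : E → ℝ}
    (hF : LipschitzWith C F) (w : E) :
    ∫ v : sphere (0 : E) 1, F (-v) * inner ℝ (v : E) w ∂μ.toSphere =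
      -∫ v : sphere (0 : E) 1, F v * inner ℝ (v : E) w ∂μ.toSphere := by
  have hF' : LipschitzWith C fun u => F (-u) := by
    exact fun x y => by simpa [edist_neg_neg] using hF (-x) (-y)
  rw [← hF.setIntegral_lineDeriv_closedBall μ w, ← hF'.setIntegral_lineDeriv_closedBall μ w,
    ← integral_neg]
  have h := (Measure.measurePreserving_neg μ).setIntegral_preimage_emb
    (MeasurableEquiv.neg E).measurableEmbedding (fun u => -lineDeriv ℝ F u w) (closedBall 0 1)
  rw [← h]
  have hpre : Neg.neg ⁻¹' closedBall (0 : E) 1 = closedBall 0 1 := by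
    ext u
    simp
  rw [hpre]
  congr 1 with u
  have h1 : (fun t : ℝ => F (-(u + t • w))) = fun t => (fun s => F (-u + s • w)) (-t) := by
    ext t
    simp only [neg_add, neg_smul]
  rw [lineDeriv, lineDeriv, h1, deriv_comp_neg (fun s => F (-u + s • w)), neg_zero]

end Neg

/-! ### The two-point estimator and the gradient of the smoothing -/

namespace ZOHFL

open Metric

variable {n : ℕ}

/-- The symmetric two-point estimator `(n / 2η) (F (x + ηv) - F (x - ηv)) v`. -/
noncomputable def twoPoint (η : ℝ) (F : Vec n → ℝ) (x : Vec n)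
    (v : sphere (0 : Vec n) 1) : Vec n :=
  ((n : ℝ) / (2 * η) * (F (x + η • (v : Vec n)) - F (x - η • (v : Vec n)))) • (v : Vec n)

/-- The mean of the symmetric two-point estimator. -/
noncomputable def sphereGrad (η : ℝ) (F : Vec n → ℝ) (x : Vec n) : Vec n :=
  ∫ v, twoPoint η F x v ∂sphereUniform n

theorem nontrivial_vec (hn : 0 < n) : Nontrivial (Vec n) :=
  Module.nontrivial_of_finrank_pos (R := ℝ) (by simpa using hn)

theorem volume_real_ball_pos : 0 < (volume : Measure (Vec n)).real (ball 0 1) :=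
  ENNReal.toReal_pos (measure_ball_pos _ 0 one_pos).ne' measure_ball_lt_top.ne

theorem isProbabilityMeasure_sphereUniform (hn : 0 < n) :
    IsProbabilityMeasure (sphereUniform n) := by
  have := nontrivial_vec hn
  refine ⟨?_⟩
  rw [sphereUniform, Measure.smul_apply, smul_eq_mul]
  exact ENNReal.inv_mul_cancel
    (Measure.measure_univ_ne_zero.2 (Measure.toSphere_ne_zero _)) (measure_ne_top _ _)

theorem integral_sphereUniform (f : sphere (0 : Vec n) 1 → ℝ) :
    ∫ v, f v ∂sphereUniform n =
      ((n : ℝ) * (volume : Measure (Vec n)).real (ball 0 1))⁻¹ *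
        ∫ v, f v ∂(volume : Measure (Vec n)).toSphere := by
  rw [sphereUniform, integral_smul_measure, ENNReal.toReal_inv, ← measureReal_def,
    Measure.toSphere_real_apply_univ]
  simp

theorem continuous_twoPoint {η : ℝ} {F : Vec n → ℝ} (hF : Continuous F) :
    Continuous fun q : Vec n × sphere (0 : Vec n) 1 => twoPoint η F q.1 q.2 := by
  unfold twoPoint
  fun_prop

theorem norm_twoPoint {η : ℝ} (hη : 0 < η) (F : Vec n → ℝ) (x : Vec n)
    (v : sphere (0 : Vec n) 1) :
    ‖twoPoint η F x v‖ =
      (n : ℝ) / (2 * η) * |F (x + η • (v : Vec n)) - F (x - η • (v : Vec n))| := by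
  rw [twoPoint, norm_smul, norm_eq_of_mem_sphere, mul_one, norm_mul, Real.norm_eq_abs,
    Real.norm_eq_abs, abs_of_nonneg (by positivity : 0 ≤ (n : ℝ) / (2 * η))]

theorem norm_twoPoint_le {η : ℝ} (hη : 0 < η) {C : ℝ≥0} {F : Vec n → ℝ} (hF : LipschitzWith C F)
    (x : Vec n) (v : sphere (0 : Vec n) 1) : ‖twoPoint η F x v‖ ≤ n * C := by
  rw [norm_twoPoint hη]
  have h := hF.dist_le_mul (x + η • (v : Vec n)) (x - η • (v : Vec n))
  rw [Real.dist_eq, dist_eq_norm, show x + η • (v : Vec n) - (x - η • (v : Vec n)) =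
    (2 * η) • (v : Vec n) by module, norm_smul, norm_eq_of_mem_sphere, mul_one,
    Real.norm_of_nonneg (by positivity)] at h
  calc _ ≤ (n : ℝ) / (2 * η) * (C * (2 * η)) := by gcongr
    _ = n * C := by field_simp

theorem norm_twoPoint_sub_le {η : ℝ} (hη : 0 < η) {C : ℝ≥0} {F : Vec n → ℝ}
    (hF : LipschitzWith C F) (x y : Vec n) (v : sphere (0 : Vec n) 1) :
    ‖twoPoint η F x v - twoPoint η F y v‖ ≤ n * C / η * ‖x - y‖ := by
  rw [twoPoint, twoPoint, ← sub_smul, ← mul_sub, norm_smul, norm_eq_of_mem_sphere, mul_one,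
    norm_mul, Real.norm_of_nonneg (by positivity)]
  have h1 := hF.dist_le_mul (x + η • (v : Vec n)) (y + η • (v : Vec n))
  have h2 := hF.dist_le_mul (x - η • (v : Vec n)) (y - η • (v : Vec n))
  rw [dist_add_right, Real.dist_eq, dist_eq_norm] at h1
  rw [dist_sub_right, Real.dist_eq, dist_eq_norm] at h2
  have h3 : ‖F (x + η • (v : Vec n)) - F (x - η • (v : Vec n)) -
      (F (y + η • (v : Vec n)) - F (y - η • (v : Vec n)))‖ ≤ 2 * (C * ‖x - y‖) := by
    rw [sub_sub_sub_comm, two_mul]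
    exact (norm_sub_le _ _).trans (add_le_add h1 h2)
  calc _ ≤ (n : ℝ) / (2 * η) * (2 * (C * ‖x - y‖)) := by gcongr
    _ = _ := by field_simp

theorem integrable_twoPoint (hn : 0 < n) {η : ℝ} (hη : 0 < η) {C : ℝ≥0} {F : Vec n → ℝ}
    (hF : LipschitzWith C F) (x : Vec n) : Integrable (twoPoint η F x) (sphereUniform n) := by
  have := isProbabilityMeasure_sphereUniform hn
  refine Integrable.of_bound (Continuous.aestronglyMeasurable ?_) (n * C)
    (ae_of_all _ (norm_twoPoint_le hη hF x))
  exact (continuous_twoPoint hF.continuous).comp (by fun_prop : Continuous fun v => (x, v))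

theorem norm_sphereGrad_le (hn : 0 < n) {η : ℝ} (hη : 0 < η) {C : ℝ≥0} {F : Vec n → ℝ}
    (hF : LipschitzWith C F) (x : Vec n) : ‖sphereGrad η F x‖ ≤ n * C := by
  have := isProbabilityMeasure_sphereUniform hn
  simpa [sphereGrad] using norm_integral_le_of_norm_le_const (μ := sphereUniform n)
    (ae_of_all _ (norm_twoPoint_le hη hF x))

theorem norm_sphereGrad_sub_le (hn : 0 < n) {η : ℝ} (hη : 0 < η) {C : ℝ≥0} {F : Vec n → ℝ}
    (hF : LipschitzWith C F) (x y : Vec n) :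
    ‖sphereGrad η F x - sphereGrad η F y‖ ≤ n * C / η * ‖x - y‖ := by
  have := isProbabilityMeasure_sphereUniform hn
  rw [sphereGrad, sphereGrad, ← integral_sub (integrable_twoPoint hn hη hF x)
    (integrable_twoPoint hn hη hF y)]
  simpa using norm_integral_le_of_norm_le_const (μ := sphereUniform n)
    (ae_of_all _ (norm_twoPoint_sub_le hη hF x y))

theorem continuous_sphereGrad (hn : 0 < n) {η : ℝ} (hη : 0 < η) {C : ℝ≥0} {F : Vec n → ℝ}
    (hF : LipschitzWith C F) : Continuous (sphereGrad η F) :=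
  (LipschitzWith.of_dist_le_mul (K := ⟨n * C / η, by positivity⟩) fun x y => by
    rw [dist_eq_norm, dist_eq_norm]
    exact norm_sphereGrad_sub_le hn hη hF x y).continuous

/-- By antipodal symmetry the two evaluation points contribute equally, which cancels the `2` in `n
/ 2η`. The surface measure is `n` times the volume of the ball, which cancels the `n`. -/
theorem inner_sphereGrad (hn : 0 < n) {η : ℝ} (hη : 0 < η) {C : ℝ≥0} {F : Vec n → ℝ}
    (hF : LipschitzWith C F) (x w : Vec n) :
    inner ℝ (sphereGrad η F x) w = ((volume : Measure (Vec n)).real (ball 0 1))⁻¹ *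
      (η⁻¹ * ∫ v : sphere (0 : Vec n) 1, F (x + η • (v : Vec n)) * inner ℝ (v : Vec n) w
        ∂(volume : Measure (Vec n)).toSphere) := by
  have := nontrivial_vec hn
  have hG : LipschitzWith (C * ‖η‖₊) fun u : Vec n => F (x + η • u) := by
    refine hF.comp (LipschitzWith.of_dist_le_mul fun u v => ?_)
    simp [dist_smul₀]
  have hodd := hG.integral_toSphere_neg_mul_inner volume w
  have hint : ∀ s : ℝ, Integrable (fun v : sphere (0 : Vec n) 1 =>
      F (x + (s * η) • (v : Vec n)) * inner ℝ (v : Vec n) w)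
      (volume : Measure (Vec n)).toSphere := fun s => by
    have hFc := hF.continuous
    exact (Continuous.integrable_of_hasCompactSupport (by fun_prop)
      (HasCompactSupport.of_compactSpace _))
  have h1 := hint 1
  have h2 := hint (-1)
  simp only [one_mul, neg_mul, neg_smul, ← sub_eq_add_neg] at h1 h2
  rw [real_inner_comm, sphereGrad, ← integral_inner (integrable_twoPoint hn hη hF x),
    integral_sphereUniform]
  have hI : ∀ v : sphere (0 : Vec n) 1, inner ℝ w (twoPoint η F x v) = (n : ℝ) / (2 * η) *
      (F (x + η • (v : Vec n)) * inner ℝ (v : Vec n) w -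
        F (x - η • (v : Vec n)) * inner ℝ (v : Vec n) w) := fun v => by
    rw [twoPoint, inner_smul_right, real_inner_comm]
    ring
  simp only [smul_neg, ← sub_eq_add_neg] at hodd
  have hn' : (0 : ℝ) < n := by exact_mod_cast hn
  have hV := volume_real_ball_pos (n := n)
  simp_rw [hI]
  rw [integral_const_mul, integral_sub h1 h2, hodd]
  field_simp
  ring

/-- The gradient of the spherical smoothing is the mean of the two-point estimator. -/
theorem hasGradientAt_ballSmooth (hn : 0 < n) {η : ℝ} (hη : 0 < η) {C : ℝ≥0} {F : Vec n → ℝ}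
    (hF : LipschitzWith C F) (x : Vec n) :
    HasGradientAt (ballSmooth η F) (sphereGrad η F x) x := by
  have := nontrivial_vec hn
  set G : Vec n → ℝ := fun u => F (x + η • u) with hGdef
  have hG : LipschitzWith (C * ‖η‖₊) G := by
    refine hF.comp (LipschitzWith.of_dist_le_mul fun u v => ?_)
    simp [dist_smul₀]
  have hFc := hF.continuous
  -- Differentiation under the integral: the Lipschitz constant dominates, and Rademacher's theorem
  -- gives differentiability for almost every `u`. Moving `x` to `x'` amounts to moving `u` by `η⁻¹
  -- (x' - x)`, hence the factor `η⁻¹`.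
  obtain ⟨hi, hd⟩ := hasFDerivAt_integral_of_dominated_loc_of_lip' (𝕜 := ℝ)
    (μ := volume.restrict (closedBall (0 : Vec n) 1)) (F := fun x' u => F (x' + η • u))
    (F' := fun u => η⁻¹ • fderiv ℝ G u) (x₀ := x) (s := Set.univ) (bound := fun _ => C)
    univ_mem (fun x' _ => (by fun_prop : Continuous fun u => F (x' + η • u)).aestronglyMeasurable)
    ((by fun_prop : Continuous fun u => F (x + η • u)).continuousOn.integrableOn_compact
      (isCompact_closedBall _ _))
    ((measurable_fderiv ℝ G).const_smul η⁻¹).aestronglyMeasurable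
    (ae_of_all _ fun u x' _ => by
      have h := hF.dist_le_mul (x' + η • u) (x + η • u)
      rwa [dist_add_right, dist_eq_norm, dist_eq_norm] at h)
    (integrableOn_const measure_closedBall_lt_top.ne)
    (by
      refine ae_restrict_of_ae ?_
      filter_upwards [hG.ae_differentiableAt] with u hu
      have h1 : HasFDerivAt (fun x' : Vec n => u + η⁻¹ • (x' - x))
          (η⁻¹ • ContinuousLinearMap.id ℝ (Vec n)) x :=
        (((hasFDerivAt_id x).sub_const x).const_smul η⁻¹).const_add u
      have h2 : HasFDerivAt G (fderiv ℝ G u) (u + η⁻¹ • (x - x)) := by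
        simpa using hu.hasFDerivAt
      have h3 := h2.comp x h1
      convert h3 using 1
      · ext x'
        change F (x' + η • u) = F (x + η • (u + η⁻¹ • (x' - x)))
        rw [smul_add, smul_inv_smul₀ hη.ne']
        congr 1
        abel
      · ext w
        simp)
  rw [hasGradientAt_iff_hasFDerivAt]
  have hbs : ballSmooth η F = fun x' => ((volume : Measure (Vec n)).real (ball 0 1))⁻¹ *
      ∫ u in closedBall (0 : Vec n) 1, F (x' + η • u) := by
    ext x'
    rw [ballSmooth, setAverage_eq, measureReal_def, Measure.addHaar_closedBall_eq_addHaar_ball,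
      ← measureReal_def, smul_eq_mul]
  rw [hbs]
  refine (hd.const_mul (((volume : Measure (Vec n)).real (ball 0 1))⁻¹)).congr_fderiv ?_
  ext w
  rw [InnerProductSpace.toDual_apply_apply, inner_sphereGrad hn hη hF,
    _root_.smul_apply, ContinuousLinearMap.integral_apply hi, smul_eq_mul,
    ← hG.setIntegral_lineDeriv_closedBall volume w, ← integral_const_mul η⁻¹]
  congr 1
  refine integral_congr_ae (ae_restrict_of_ae ?_)
  filter_upwards [hG.ae_differentiableAt] with u hu
  rw [hu.lineDeriv_eq_fderiv, _root_.smul_apply, smul_eq_mul]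

/-- A quadratic bound for the first-order expansion of a function with Lipschitz gradient. -/
theorem abs_sub_sub_inner_le {f : Vec n → ℝ} {f' : Vec n → Vec n} {K : ℝ}
    (hf : ∀ x, HasGradientAt f (f' x) x) (hf' : ∀ x y, ‖f' x - f' y‖ ≤ K * ‖x - y‖) (x y : Vec n) :
    |f y - f x - inner ℝ (f' x) (y - x)| ≤ K * ‖y - x‖ ^ 2 := by
  have h := (convex_segment (𝕜 := ℝ) x y).norm_image_sub_le_of_norm_hasFDerivWithin_le'
    (f := f) (f' := fun z => InnerProductSpace.toDual ℝ (Vec n) (f' z))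
    (φ := InnerProductSpace.toDual ℝ (Vec n) (f' x)) (C := K * ‖y - x‖)
    (fun z _ => (hf z).hasFDerivAt.hasFDerivWithinAt)
    (fun z hz => by
      rw [← map_sub, LinearIsometryEquiv.norm_map]
      refine (hf' z x).trans ?_
      -- The sign of `K` is not given: it is nonnegative as soon as two distinct points exist, so
      -- the degenerate cases are separated.
      rcases eq_or_ne z x with rfl | hzx
      · simp only [sub_self, norm_zero, mul_zero]
        rcases eq_or_ne y z with rfl | hyz
        · simp
        · exact (norm_nonneg _).trans (hf' y z)
      · have hK : 0 ≤ K := by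
          have h0 := (norm_nonneg _).trans (hf' z x)
          exact nonneg_of_mul_nonneg_left h0 (norm_sub_pos_iff.2 hzx)
        gcongr
        exact norm_sub_le_of_mem_segment hz)
    (left_mem_segment ℝ x y) (right_mem_segment ℝ x y)
  rw [InnerProductSpace.toDual_apply_apply, Real.norm_eq_abs] at h
  exact h.trans (by rw [pow_two, mul_assoc])

/-- A function bounded below that satisfies a quadratic upper bound controls its gradient. -/
theorem norm_sq_le_of_quadratic_bound {f : Vec n → ℝ} {g x : Vec n} {K b : ℝ} (hK : 0 < K)
    (hb : ∀ y, b ≤ f y)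
    (h : ∀ y, f y ≤ f x + inner ℝ g (y - x) + K * ‖y - x‖ ^ 2) :
    ‖g‖ ^ 2 ≤ 4 * K * (f x - b) := by
  -- This point minimizes the quadratic upper bound.
  have h1 := (hb _).trans (h (x - (2 * K)⁻¹ • g))
  rw [sub_sub_cancel_left, norm_neg, inner_neg_right, inner_smul_right,
    real_inner_self_eq_norm_sq, norm_smul, Real.norm_of_nonneg (by positivity), mul_pow] at h1
  have h2 : K * ((2 * K)⁻¹ ^ 2 * ‖g‖ ^ 2) = (4 * K)⁻¹ * ‖g‖ ^ 2 := by field_simp; ring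
  have h3 : (2 * K)⁻¹ * ‖g‖ ^ 2 = 2 * ((4 * K)⁻¹ * ‖g‖ ^ 2) := by field_simp; ring
  rw [h2, h3] at h1
  have h4 : (4 * K)⁻¹ * ‖g‖ ^ 2 ≤ f x - b := by linarith
  rwa [inv_mul_le_iff₀ (by positivity)] at h4

/-! ### Gradient and quadratic upper bound of the smoothed objective -/

section Objective

variable {m : ℕ} {D : Type*} [MeasurableSpace D] {Z : Fin m → Type*} [∀ i, MeasurableSpace (Z i)]
  {p : Problem n m D Z} {c : Constants m}

/-- The gradient of the smoothed global objective. -/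
noncomputable def Problem.gradfη (p : Problem n m D Z) (η : ℝ) (x : Vec n) : Vec n :=
  gradient p.f₁ x + (1 / (m : ℝ)) • ∑ i, sphereGrad η (p.f₂imp i) x

theorem hasGradientAt_f₂η (hn : 0 < n) (hA : MainAssumption p c) {η : ℝ} (hη : 0 < η)
    (x : Vec n) :
    HasGradientAt (p.f₂η η) ((1 / (m : ℝ)) • ∑ i, sphereGrad η (p.f₂imp i) x) x := by
  rw [hasGradientAt_iff_hasFDerivAt]
  have h := (HasFDerivAt.fun_sum (u := Finset.univ) fun i _ =>
    (hasGradientAt_ballSmooth hn hη (hA.lip_imp i) x).hasFDerivAt).const_mul (1 / (m : ℝ))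
  refine h.congr_fderiv ?_
  simp

theorem hasGradientAt_fη (hn : 0 < n) (hA : MainAssumption p c) {η : ℝ} (hη : 0 < η)
    (x : Vec n) : HasGradientAt (p.fη η) (p.gradfη η x) x := by
  have h1 : HasGradientAt p.f₁ (gradient p.f₁ x) x :=
    ((hA.smooth_f₁.1.differentiable (by simp)) x).hasGradientAt
  rw [hasGradientAt_iff_hasFDerivAt]
  refine (h1.hasFDerivAt.add (hasGradientAt_f₂η hn hA hη x).hasFDerivAt).congr_fderiv ?_
  simp [Problem.gradfη]

theorem continuous_gradient_f₁ (hA : MainAssumption p c) : Continuous (gradient p.f₁) := by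
  have h := hA.smooth_f₁.1.continuous_fderiv (by simp)
  exact (InnerProductSpace.toDual ℝ (Vec n)).symm.continuous.comp h

theorem continuous_gradfη (hn : 0 < n) (hA : MainAssumption p c) {η : ℝ} (hη : 0 < η) :
    Continuous (p.gradfη η) := by
  have h := fun i => continuous_sphereGrad hn hη (hA.lip_imp i)
  exact (continuous_gradient_f₁ hA).add (by fun_prop)

theorem norm_mean_le (hm : 0 < m) {g : Fin m → Vec n} {B : ℝ} (hg : ∀ i, ‖g i‖ ≤ B) :
    ‖(1 / (m : ℝ)) • ∑ i, g i‖ ≤ B := by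
  have hm' : (0 : ℝ) < m := by exact_mod_cast hm
  rw [norm_smul, Real.norm_of_nonneg (by positivity), one_div, inv_mul_le_iff₀ hm']
  refine (norm_sum_le _ _).trans ((Finset.sum_le_sum fun i _ => hg i).trans ?_)
  simp

/-- The descent inequality handles `f₁`, and the Lipschitz gradient handles the smoothed part. The
constant is not sharp; the summand `1` makes it strictly positive. -/
theorem fη_le_quadratic (hn : 0 < n) (hm : 0 < m) (hA : MainAssumption p c) {η : ℝ} (hη : 0 < η)
    (x y : Vec n) :
    p.fη η y ≤ p.fη η x + inner ℝ (p.gradfη η x) (y - x) +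
      (c.L₁f₁ + n * c.L₀imp / η + 1) * ‖y - x‖ ^ 2 := by
  have h1 := hA.smooth_f₁.2 x y
  have h2 := (abs_le.1 (abs_sub_sub_inner_le (K := n * c.L₀imp / η)
    (fun x => hasGradientAt_f₂η hn hA hη x) (fun x y => by
      rw [← smul_sub, ← Finset.sum_sub_distrib]
      exact norm_mean_le hm fun i => norm_sphereGrad_sub_le hn hη (hA.lip_imp i) x y) x y)).2
  have h3 : 0 ≤ (c.L₁f₁ : ℝ) * ‖y - x‖ ^ 2 := by positivity
  have h4 : 0 ≤ ‖y - x‖ ^ 2 := by positivity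
  simp only [Problem.fη, Problem.gradfη, inner_add_left]
  linarith

end Objective

universe u v w

/-! ### Averaging over a sample independent of the past -/

section Independence

variable {Ω : Type*} {𝓕 mΩ : MeasurableSpace Ω} {P : Measure Ω} [IsProbabilityMeasure P]
  {T S : Type*} [MeasurableSpace T] [MeasurableSpace S]
  {X : Ω → T} {ξ : Ω → S}

theorem map_prod_eq_of_indep (h𝓕 : 𝓕 ≤ mΩ) (hX : Measurable[𝓕] X) (hξ : Measurable ξ)
    (hind : Indep (MeasurableSpace.comap ξ inferInstance) 𝓕 P) :
    P.map (fun ω => (X ω, ξ ω)) = (P.map X).prod (P.map ξ) := by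
  have h : IndepFun X ξ P :=
    (IndepFun_iff_Indep _ _ _).2 (indep_of_indep_of_le_left hind.symm hX.comap_le)
  exact h.map_prod_eq_prod_map_map (hX.mono h𝓕 le_rfl).aemeasurable hξ.aemeasurable

theorem lintegral_le_of_indep (h𝓕 : 𝓕 ≤ mΩ) (hX : Measurable[𝓕] X) (hξ : Measurable ξ)
    (hind : Indep (MeasurableSpace.comap ξ inferInstance) 𝓕 P) {φ : T × S → ℝ≥0∞}
    (hφ : Measurable φ) {K : ℝ≥0∞} (hK : ∀ x, ∫⁻ s, φ (x, s) ∂P.map ξ ≤ K) :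
    ∫⁻ ω, φ (X ω, ξ ω) ∂P ≤ K := by
  have hX' : Measurable X := hX.mono h𝓕 le_rfl
  have hm : IsProbabilityMeasure (P.map X) := Measure.isProbabilityMeasure_map hX'.aemeasurable
  have hs : IsProbabilityMeasure (P.map ξ) := Measure.isProbabilityMeasure_map hξ.aemeasurable
  rw [← lintegral_map hφ (hX'.prodMk hξ), map_prod_eq_of_indep h𝓕 hX hξ hind,
    lintegral_prod _ hφ.aemeasurable]
  exact (lintegral_mono hK).trans (by simp)

theorem integral_eq_zero_of_indep (h𝓕 : 𝓕 ≤ mΩ) (hX : Measurable[𝓕] X) (hξ : Measurable ξ)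
    (hind : Indep (MeasurableSpace.comap ξ inferInstance) 𝓕 P) {φ : T × S → ℝ}
    (hφ : Measurable φ) (h0 : ∀ x, ∫ s, φ (x, s) ∂P.map ξ = 0)
    (hint : Integrable (fun ω => φ (X ω, ξ ω)) P) : ∫ ω, φ (X ω, ξ ω) ∂P = 0 := by
  have hX' : Measurable X := hX.mono h𝓕 le_rfl
  have hm : IsProbabilityMeasure (P.map X) := Measure.isProbabilityMeasure_map hX'.aemeasurable
  have hs : IsProbabilityMeasure (P.map ξ) := Measure.isProbabilityMeasure_map hξ.aemeasurable
  have hmap := map_prod_eq_of_indep h𝓕 hX hξ hind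
  have hi : Integrable φ ((P.map X).prod (P.map ξ)) := by
    rw [← hmap]
    exact (integrable_map_measure hφ.aestronglyMeasurable (hX'.prodMk hξ).aemeasurable).2 hint
  rw [← integral_map (hX'.prodMk hξ).aemeasurable hφ.aestronglyMeasurable, hmap,
    integral_prod _ hi]
  simp [h0]

/-- This is the martingale-difference property in integrated form: with the past frozen, the noise
averages to zero, and Fubini for the product law does the rest. -/
theorem setIntegral_inner_eq_zero_of_indep {n : ℕ} (h𝓕 : 𝓕 ≤ mΩ) {A : Set Ω}
    (hA : MeasurableSet[𝓕] A) {x : Ω → Vec n} (hx : Measurable[𝓕] x) (hξ : Measurable ξ)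
    (hind : Indep (MeasurableSpace.comap ξ inferInstance) 𝓕 P) {g : Vec n → Vec n}
    (hg : Measurable g) {ψ : Vec n × S → Vec n} (hψ : Measurable ψ)
    (hψi : ∀ y, Integrable (fun s => ψ (y, s)) (P.map ξ))
    (h0 : ∀ y, ∫ s, ψ (y, s) ∂P.map ξ = 0)
    (hint : IntegrableOn (fun ω => inner ℝ (g (x ω)) (ψ (x ω, ξ ω))) A P) :
    ∫ ω in A, inner ℝ (g (x ω)) (ψ (x ω, ξ ω)) ∂P = 0 := by
  have hind' : ∀ ω, A.indicator (fun ω => inner ℝ (g (x ω)) (ψ (x ω, ξ ω))) ω =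
      (A.indicator (fun _ => (1 : ℝ)) ω) * inner ℝ (g (x ω)) (ψ (x ω, ξ ω)) := fun ω => by
    by_cases h : ω ∈ A <;> simp [h]
  rw [← integral_indicator (h𝓕 _ hA)]
  replace hint := (integrable_indicator_iff (h𝓕 _ hA)).2 hint
  replace hint := (integrable_congr (ae_of_all P hind')).1 hint
  simp_rw [hind']
  -- The indicator of `A` becomes a coordinate of the past variable, so the event needs no separate
  -- treatment.
  refine integral_eq_zero_of_indep (X := fun ω => (A.indicator (fun _ => (1 : ℝ)) ω, x ω))
    (φ := fun q : (ℝ × Vec n) × S => q.1.1 * inner ℝ (g q.1.2) (ψ (q.1.2, q.2)))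
    h𝓕 (Measurable.prodMk (measurable_const.indicator hA) hx) hξ hind ?_ ?_ hint
  · exact measurable_fst.fst.mul ((hg.comp measurable_fst.snd).inner
      (hψ.comp (measurable_fst.snd.prodMk measurable_snd)))
  · intro y
    simp only
    rw [integral_const_mul, integral_inner (hψi _), h0, inner_zero_right, mul_zero]

end Independence

/-! ### Measurability of the iterates with respect to the histories -/

section Measurability

variable {n m : ℕ} {D : Type u} {Z : Fin m → Type v}
  [∀ i, MeasurableSpace (Z i)] {Ω : Type w} {a : Run n m Ω D Z}

namespace Run

omit [∀ i, MeasurableSpace (Z i)] in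
theorem measurable_evalPt {𝓕 : MeasurableSpace Ω} {r : ℕ} {i : Fin m} {b : Bool}
    {x : Ω → Vec n} (hx : Measurable[𝓕] x) (hv : Measurable[𝓕] (a.v i r)) :
    Measurable[𝓕] fun ω => a.evalPt r ω (x ω) i b :=
  hx.add ((measurable_subtype_coe.comp hv).const_smul (sgn b * a.η))

theorem le_clientHistory (F : MeasurableSpace Ω) (i : Fin m) (r : ℕ) (b : Bool) {s t : ℕ}
    (hst : s ≤ t) : a.clientHistory F i r b s ≤ a.clientHistory F i r b t := by
  induction hst with
  | refl => exact le_rfl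
  | step _ ih => exact ih.trans le_sup_left

end Run

variable [MeasurableSpace D] {p : Problem n m D Z} {c : Constants m}

/-- Continuity in `y` and a Lipschitz bound in `x` uniform in `y` give joint continuity. -/
theorem measurable_f₂ (hA : MainAssumption p c) :
    Measurable fun q : Vec n × Vec n => p.f₂ q.1 q.2 :=
  (continuous_prod_of_continuous_lipschitzWith _ c.L₀x (fun x => (hA.lip_y x).continuous)
    fun y => hA.lip_x y).measurable

theorem measurable_projStep (hp : p.WellPosed) {Ω : Type w} [MeasurableSpace Ω] (i : Fin m)
    (s : ℝ) {x y : Ω → Vec n} {z : Ω → Z i} (hx : Measurable x) (hy : Measurable y)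
    (hz : Measurable z) :
    Measurable fun ω => proj (p.Y i (x ω)) (y ω - s • p.gradhs i (x ω) (y ω) (z ω)) := by
  have h1 : Measurable fun ω => p.gradhs i (x ω) (y ω) (z ω) :=
    (hp.measurable_gradhs i).comp (hx.prodMk (hy.prodMk hz))
  have h2 : Measurable fun ω => (x ω, y ω - s • p.gradhs i (x ω) (y ω) (z ω)) :=
    hx.prodMk (hy.sub (h1.fun_const_smul s))
  have h3 := (hp.measurable_proj i).comp h2
  simp only [Function.comp_def] at h3
  exact h3

theorem measurable_localIter (hp : p.WellPosed) {Ω : Type w} [MeasurableSpace Ω] (i : Fin m)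
    (step : ℕ → ℝ) {x y₀ : Ω → Vec n} {z : ℕ → Ω → Z i} {t : ℕ} (hx : Measurable x)
    (hy : Measurable y₀) (hz : ∀ s < t, Measurable (z s)) :
    Measurable fun ω => localIter p i step (x ω) (y₀ ω) (fun s => z s ω) t := by
  induction t with
  | zero => exact hy
  | succ t ih =>
    have ih' := ih fun s hs => hz s (hs.trans t.lt_succ_self)
    exact measurable_projStep hp i (step t) hx ih' (hz t t.lt_succ_self)

namespace Run

theorem measurable_yOut (hp : p.WellPosed) {𝓕 : MeasurableSpace Ω} {r : ℕ} {i : Fin m}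
    {b : Bool} {x : Ω → Vec n} (hx : Measurable[𝓕] x) (hv : Measurable[𝓕] (a.v i r))
    (hy : Measurable[𝓕] (a.y₀ i r b)) (hζ : ∀ t < a.H i r, Measurable[𝓕] (a.ζ i r b t)) :
    Measurable[𝓕] fun ω => a.yOut p r ω (x ω) i b :=
  measurable_localIter hp i (a.γloc i) (measurable_evalPt hx hv) hy hζ

theorem measurable_gClient (hp : p.WellPosed) (hA : MainAssumption p c)
    {𝓕 : MeasurableSpace Ω} {r : ℕ} {i : Fin m} {x : Ω → Vec n} (hx : Measurable[𝓕] x)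
    (hv : Measurable[𝓕] (a.v i r)) (hy : ∀ b, Measurable[𝓕] (a.y₀ i r b))
    (hζ : ∀ b, ∀ t < a.H i r, Measurable[𝓕] (a.ζ i r b t)) :
    Measurable[𝓕] fun ω => a.gClient p r ω (x ω) i := by
  have h : ∀ b, Measurable[𝓕] fun ω =>
      p.f₂ (a.evalPt r ω (x ω) i b) (a.yOut p r ω (x ω) i b) := fun b =>
    (measurable_f₂ hA).comp ((measurable_evalPt hx hv).prodMk
      (measurable_yOut hp hx hv (hy b) (hζ b)))
  exact (((h true).sub (h false)).const_mul _).smul (measurable_subtype_coe.comp hv)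

omit [MeasurableSpace D] in
theorem measurable_v_clientHistory (F : MeasurableSpace Ω) (i : Fin m) (r : ℕ) (b : Bool) (t : ℕ)
    (j : Fin m) : Measurable[a.clientHistory F i r b t] (a.v j r) := by
  refine measurable_iff_comap_le.2 (le_trans ?_ (le_clientHistory F i r b t.zero_le))
  exact (le_iSup (fun j => MeasurableSpace.comap (a.v j r) inferInstance) j).trans
    (le_sup_right.trans le_sup_left)

omit [MeasurableSpace D] in
theorem measurable_y₀_clientHistory (F : MeasurableSpace Ω) (i : Fin m) (r : ℕ) (b : Bool)
    (t : ℕ) : Measurable[a.clientHistory F i r b t] (a.y₀ i r b) :=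
  measurable_iff_comap_le.2 (le_sup_right.trans (le_clientHistory F i r b t.zero_le))

omit [MeasurableSpace D] in
theorem measurable_ζ_clientHistory (F : MeasurableSpace Ω) (i : Fin m) (r : ℕ) (b : Bool)
    {s t : ℕ} (hst : s < t) : Measurable[a.clientHistory F i r b t] (a.ζ i r b s) :=
  measurable_iff_comap_le.2
    (le_sup_right.trans (le_clientHistory F i r b (Nat.succ_le_of_lt hst)))

theorem history_mono {r s : ℕ} (hrs : r ≤ s) : a.history r ≤ a.history s := by
  induction hrs with
  | refl => exact le_rfl
  | step _ ih => exact ih.trans (le_sup_left.trans le_sup_left)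

theorem clientHistory_le_history (i : Fin m) (r : ℕ) (b : Bool) :
    a.clientHistory (a.history r) i r b (a.H i r) ≤ a.history (r + 1) :=
  (le_iSup₂ (f := fun i b => a.clientHistory (a.history r) i r b (a.H i r)) i b).trans
    (le_sup_right.trans le_sup_left)

variable {mΩ : MeasurableSpace Ω} {P : Measure Ω}

theorem IsAdmissible.clientHistory_le (ha : a.IsAdmissible p P) {r : ℕ}
    (hF : a.history r ≤ mΩ) (i : Fin m) (b : Bool) (t : ℕ) :
    a.clientHistory (a.history r) i r b t ≤ mΩ := by
  induction t with
  | zero =>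
    exact sup_le (sup_le hF (iSup_le fun j => (ha.measurable_v j r).comap_le))
      (ha.measurable_y₀ i r b).comap_le
  | succ t ih => exact sup_le ih (ha.measurable_ζ i r b t).comap_le

theorem IsAdmissible.history_le (ha : a.IsAdmissible p P) (r : ℕ) :
    a.history r ≤ mΩ := by
  induction r with
  | zero => exact ha.measurable_x₀.comap_le
  | succ r ih =>
    exact sup_le (sup_le ih (iSup₂_le fun i b => ha.clientHistory_le ih i b _))
      (ha.measurable_ξ r).comap_le

theorem measurable_xhat (hp : p.WellPosed) (hA : MainAssumption p c) (r : ℕ) :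
    Measurable[a.history r] (a.xhat p r) := by
  induction r with
  | zero => exact comap_measurable _
  | succ r ih =>
    have hx : Measurable[a.history (r + 1)] (a.xhat p r) := ih.mono (history_mono r.le_succ) le_rfl
    have hξ : Measurable[a.history (r + 1)] (a.ξ r) := measurable_iff_comap_le.2 le_sup_right
    have hg : ∀ i, Measurable[a.history (r + 1)] fun ω => a.gClient p r ω (a.xhat p r ω) i :=
      fun i => measurable_gClient hp hA hx
        -- Local histories of either sign contain all directions of the round; `true` is an
        -- arbitrary choice.
        ((measurable_v_clientHistory _ i r true _ i).mono (clientHistory_le_history i r true) le_rfl)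
        (fun b => (measurable_y₀_clientHistory _ i r b _).mono
          (clientHistory_le_history i r b) le_rfl)
        (fun b t ht => (measurable_ζ_clientHistory _ i r b ht).mono
          (clientHistory_le_history i r b) le_rfl)
    have hs : Measurable[a.history (r + 1)] fun ω => p.gradf₁s (a.xhat p r ω) (a.ξ r ω) :=
      hp.measurable_gradf₁s.comp (hx.prodMk hξ)
    have hG : Measurable[a.history (r + 1)] fun ω =>
        ∑ i, a.gClient p r ω (a.xhat p r ω) i :=
      Finset.measurable_fun_sum _ fun i _ => hg i
    have hG' : Measurable[a.history (r + 1)] fun ω =>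
        (1 / (m : ℝ)) • ∑ i, a.gClient p r ω (a.xhat p r ω) i := hG.fun_const_smul _
    exact hx.sub ((hs.add hG').const_smul (a.γ r))

end Run

end Measurability

/-! ### Integrability, one-step descent and summability tools -/

section Auxiliary

variable {Ω : Type*} [MeasurableSpace Ω] {μ : Measure Ω} {n : ℕ}

theorem integrable_norm_sq_of_lintegral_le {N : Ω → Vec n} (hN : Measurable N) {k : ℝ≥0}
    (h : ∫⁻ ω, ‖N ω‖ₑ ^ 2 ∂μ ≤ k) :
    Integrable (fun ω => ‖N ω‖ ^ 2) μ ∧ ∫ ω, ‖N ω‖ ^ 2 ∂μ ≤ k := by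
  have he : ∀ ω, ENNReal.ofReal (‖N ω‖ ^ 2) = ‖N ω‖ₑ ^ 2 := fun ω => by
    rw [ENNReal.ofReal_pow (norm_nonneg _), ofReal_norm]
  have h0 : 0 ≤ᵐ[μ] fun ω => ‖N ω‖ ^ 2 := ae_of_all _ fun ω => sq_nonneg _
  have hm : AEStronglyMeasurable (fun ω => ‖N ω‖ ^ 2) μ :=
    (hN.norm.pow_const 2).aestronglyMeasurable
  refine ⟨⟨hm, ?_⟩, ?_⟩
  · rw [hasFiniteIntegral_iff_ofReal h0]
    simp_rw [he]
    exact h.trans_lt ENNReal.coe_lt_top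
  · rw [integral_eq_lintegral_of_nonneg_ae h0 hm]
    simp_rw [he]
    exact ENNReal.toReal_le_of_le_ofReal k.2 (by simpa using h)

theorem integrable_inner_of_norm_sq {f g : Ω → Vec n} (hf : Measurable f) (hg : Measurable g)
    (hf2 : Integrable (fun ω => ‖f ω‖ ^ 2) μ) (hg2 : Integrable (fun ω => ‖g ω‖ ^ 2) μ) :
    Integrable (fun ω => inner ℝ (f ω) (g ω)) μ := by
  refine (hf2.add hg2).mono' (hf.inner hg).aestronglyMeasurable (ae_of_all _ fun ω => ?_)
  have h1 := abs_real_inner_le_norm (f ω) (g ω)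
  have h2 := two_mul_le_add_sq ‖f ω‖ ‖g ω‖
  have h3 : 0 ≤ ‖f ω‖ * ‖g ω‖ := by positivity
  rw [Real.norm_eq_abs, Pi.add_apply]
  linarith

theorem integral_descent_terms {V G I J E N M : Ω → ℝ} (a b c d : ℝ) (hV : Integrable V μ)
    (hG : Integrable G μ) (hI : Integrable I μ) (hJ : Integrable J μ) (hE : Integrable E μ)
    (hN : Integrable N μ) (hM : Integrable M μ) :
    Integrable (fun ω => V ω - a * G ω - b * (I ω + J ω) + c * E ω + d * (N ω + M ω)) μ ∧
      ∫ ω, (V ω - a * G ω - b * (I ω + J ω) + c * E ω + d * (N ω + M ω)) ∂μ =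
        ∫ ω, V ω ∂μ - a * ∫ ω, G ω ∂μ - b * (∫ ω, I ω ∂μ + ∫ ω, J ω ∂μ) + c * ∫ ω, E ω ∂μ +
          d * (∫ ω, N ω ∂μ + ∫ ω, M ω ∂μ) := by
  have h1 : Integrable (fun ω => V ω - a * G ω) μ := hV.sub (hG.const_mul a)
  have hb : Integrable (fun ω => b * (I ω + J ω)) μ := (hI.add hJ).const_mul b
  have h2 : Integrable (fun ω => V ω - a * G ω - b * (I ω + J ω)) μ := h1.sub hb
  have h3 : Integrable (fun ω => V ω - a * G ω - b * (I ω + J ω) + c * E ω) μ :=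
    h2.add (hE.const_mul c)
  have hd : Integrable (fun ω => d * (N ω + M ω)) μ := (hN.add hM).const_mul d
  refine ⟨h3.add hd, ?_⟩
  rw [integral_add h3 hd, integral_add h2 (hE.const_mul c), integral_sub h1 hb,
    integral_sub hV (hG.const_mul a), integral_const_mul, integral_const_mul, integral_const_mul,
    integral_const_mul, integral_add hI hJ, integral_add hN hM]

theorem norm_mean_sq_le {m : ℕ} (hm : 0 < m) (g : Fin m → Vec n) :
    ‖(1 / (m : ℝ)) • ∑ i, g i‖ ^ 2 ≤ (1 / (m : ℝ)) * ∑ i, ‖g i‖ ^ 2 := by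
  have hm' : (0 : ℝ) < m := by exact_mod_cast hm
  have h1 : ‖∑ i, g i‖ ^ 2 ≤ m * ∑ i, ‖g i‖ ^ 2 := by
    refine (pow_le_pow_left₀ (norm_nonneg _) (norm_sum_le _ _) 2).trans ?_
    simpa using sq_sum_le_card_mul_sum_sq (s := Finset.univ) (f := fun i => ‖g i‖)
  rw [norm_smul, mul_pow, Real.norm_of_nonneg (by positivity)]
  calc (1 / (m : ℝ)) ^ 2 * ‖∑ i, g i‖ ^ 2 ≤ (1 / (m : ℝ)) ^ 2 * (m * ∑ i, ‖g i‖ ^ 2) := by gcongr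
    _ = _ := by field_simp

/-- One step of a perturbed gradient method on a function with a quadratic upper bound. -/
theorem perturbed_descent {f : Vec n → ℝ} {x g N M e : Vec n} {K γ : ℝ} (hγ : 0 ≤ γ)
    (hγK : 16 * K * γ ≤ 1) (hK : 0 ≤ K)
    (h : ∀ y, f y ≤ f x + inner ℝ g (y - x) + K * ‖y - x‖ ^ 2) :
    f (x - γ • (g + N + M + e)) ≤ f x - γ / 2 * ‖g‖ ^ 2 - γ * (inner ℝ g N + inner ℝ g M) +
      2 * γ * ‖e‖ ^ 2 + 4 * K * γ ^ 2 * (‖N‖ ^ 2 + ‖M‖ ^ 2) := by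
  have h1 := h (x - γ • (g + N + M + e))
  rw [sub_sub_cancel_left, norm_neg, inner_neg_right, inner_smul_right, norm_smul, mul_pow,
    Real.norm_of_nonneg hγ, inner_add_right, inner_add_right, inner_add_right,
    real_inner_self_eq_norm_sq] at h1
  have h2 : ‖g + N + M + e‖ ^ 2 ≤ 4 * (‖g‖ ^ 2 + ‖N‖ ^ 2 + ‖M‖ ^ 2 + ‖e‖ ^ 2) := by
    have : ‖g + N + M + e‖ ≤ ‖g‖ + ‖N‖ + ‖M‖ + ‖e‖ := norm_add₄_le
    refine (pow_le_pow_left₀ (norm_nonneg _) this 2).trans ?_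
    nlinarith [sq_nonneg (‖g‖ - ‖N‖), sq_nonneg (‖g‖ - ‖M‖), sq_nonneg (‖g‖ - ‖e‖),
      sq_nonneg (‖N‖ - ‖M‖), sq_nonneg (‖N‖ - ‖e‖), sq_nonneg (‖M‖ - ‖e‖)]
  have h3 : -inner ℝ g e ≤ ‖g‖ ^ 2 / 4 + ‖e‖ ^ 2 := by
    have := neg_le_of_abs_le (abs_real_inner_le_norm g e)
    nlinarith [sq_nonneg (‖g‖ / 2 - ‖e‖)]
  have h4 : K * (γ ^ 2 * ‖g + N + M + e‖ ^ 2) ≤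
      K * (γ ^ 2 * (4 * (‖g‖ ^ 2 + ‖N‖ ^ 2 + ‖M‖ ^ 2 + ‖e‖ ^ 2))) := by gcongr
  have h5 : γ * -inner ℝ g e ≤ γ * (‖g‖ ^ 2 / 4 + ‖e‖ ^ 2) := by gcongr
  -- The quadratic term and Young's inequality each cost at most `γ/4 ‖g‖²`, which leaves `γ/2` of
  -- the original `γ`.
  have h6 : 16 * K * γ * (γ * (‖g‖ ^ 2 + ‖e‖ ^ 2)) ≤ 1 * (γ * (‖g‖ ^ 2 + ‖e‖ ^ 2)) := by gcongr
  have h7 : 0 ≤ γ * ‖e‖ ^ 2 := by positivity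
  nlinarith

/-- A positive lower limit would bound `γ r` eventually by a constant times `γ r * ‖g r‖ ^ 2`,
making `γ` summable. In `ℝ≥0∞` the lower limit is meaningful without any boundedness of the
gradients. -/
theorem liminf_enorm_eq_zero {γ : ℕ → ℝ} {g : ℕ → Vec n} (hγ0 : ∀ r, 0 ≤ γ r)
    (hγ : ¬ Summable γ) (h : Summable fun r => γ r * ‖g r‖ ^ 2) :
    liminf (fun r => ‖g r‖ₑ) atTop = 0 := by
  by_contra hne
  obtain ⟨ε, hε0, hε⟩ := exists_between (pos_iff_ne_zero.2 hne)
  have hev := eventually_lt_of_lt_liminf hε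
  have hεt : ε ≠ ∞ := hε.ne_top
  have hε' : 0 < ε.toReal := ENNReal.toReal_pos hε0.ne' hεt
  refine hγ ?_
  refine Summable.of_norm_bounded_eventually_nat (h.mul_left ((ε.toReal ^ 2)⁻¹)) ?_
  filter_upwards [hev] with r hr
  have h1 : ε.toReal ≤ ‖g r‖ := by
    have := ENNReal.toReal_mono (by simp) hr.le
    simpa using this
  rw [Real.norm_of_nonneg (hγ0 r), ← div_eq_inv_mul, le_div_iff₀ (by positivity)]
  exact mul_le_mul_of_nonneg_left (pow_le_pow_left₀ hε'.le h1 2) (hγ0 r)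

/-- Nonnegative functions whose integrals have a finite sum are summable almost everywhere. -/
theorem ae_summable_of_summable_integral {F : ℕ → Ω → ℝ} (hF : ∀ r, Integrable (F r) μ)
    (h0 : ∀ r ω, 0 ≤ F r ω) (h : Summable fun r => ∫ ω, F r ω ∂μ) :
    ∀ᵐ ω ∂μ, Summable fun r => F r ω := by
  have hm : ∀ r, AEMeasurable (fun ω => ENNReal.ofReal (F r ω)) μ := fun r =>
    (hF r).aemeasurable.ennreal_ofReal
  have hfin : ∫⁻ ω, ∑' r, ENNReal.ofReal (F r ω) ∂μ ≠ ∞ := by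
    rw [lintegral_tsum hm]
    have : ∀ r, ∫⁻ ω, ENNReal.ofReal (F r ω) ∂μ = ENNReal.ofReal (∫ ω, F r ω ∂μ) := fun r =>
      (ofReal_integral_eq_lintegral_ofReal (hF r) (ae_of_all _ (h0 r))).symm
    simp_rw [this]
    exact h.tsum_ofReal_ne_top
  filter_upwards [ae_lt_top' (AEMeasurable.tsum hm) hfin] with ω hω
  have := ENNReal.summable_toReal hω.ne
  simpa [ENNReal.toReal_ofReal (h0 _ ω)] using this

end Auxiliary

/-! ### Error decomposition and expected descent of a round -/

section Descent

variable {n m : ℕ} {D : Type u} [MeasurableSpace D] {Z : Fin m → Type v}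
  [∀ i, MeasurableSpace (Z i)] {Ω : Type w} {p : Problem n m D Z} {c : Constants m}

/-- The error in the penalty caused by the inexact lower-level solution. -/
noncomputable def Run.penaltyErr (a : Run n m Ω D Z) (p : Problem n m D Z) (r : ℕ)
    (i : Fin m) (b : Bool) (ω : Ω) : ℝ :=
  p.f₂ (a.evalPt r ω (a.xhat p r ω) i b) (a.yOut p r ω (a.xhat p r ω) i b) -
    p.f₂imp i (a.evalPt r ω (a.xhat p r ω) i b)

/-- The error of the averaged zeroth-order gradient caused by the inexact lower-level solutions. -/
noncomputable def Run.gradErr (a : Run n m Ω D Z) (p : Problem n m D Z) (r : ℕ) (ω : Ω) : Vec n :=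
  (1 / (m : ℝ)) • ∑ i, (a.gClient p r ω (a.xhat p r ω) i -
    twoPoint a.η (p.f₂imp i) (a.xhat p r ω) (a.v i r ω))

/-- The deviation of the averaged exact two-point estimator from its mean. -/
noncomputable def Run.directionNoise (a : Run n m Ω D Z) (p : Problem n m D Z) (r : ℕ) (ω : Ω) : Vec n :=
  (1 / (m : ℝ)) • ∑ i, (twoPoint a.η (p.f₂imp i) (a.xhat p r ω) (a.v i r ω) -
    sphereGrad a.η (p.f₂imp i) (a.xhat p r ω))

/-- The deviation of the server's sample gradient from its mean. -/
noncomputable def Run.serverNoise (a : Run n m Ω D Z) (p : Problem n m D Z) (r : ℕ) (ω : Ω) : Vec n :=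
  p.gradf₁s (a.xhat p r ω) (a.ξ r ω) - gradient p.f₁ (a.xhat p r ω)

variable {a : Run n m Ω D Z}

/-- Adding and subtracting the exact estimator and its mean splits the step into gradient, two
centred noises and a bias. -/
theorem Run.xhat_succ (r : ℕ) (ω : Ω) :
    a.xhat p (r + 1) ω = a.xhat p r ω - a.γ r • (p.gradfη a.η (a.xhat p r ω) +
      a.serverNoise p r ω + a.directionNoise p r ω + a.gradErr p r ω) := by
  have h : p.gradfη a.η (a.xhat p r ω) + a.serverNoise p r ω + a.directionNoise p r ω +
      a.gradErr p r ω = p.gradf₁s (a.xhat p r ω) (a.ξ r ω) +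
        (1 / (m : ℝ)) • ∑ i, a.gClient p r ω (a.xhat p r ω) i := by
    simp only [Problem.gradfη, serverNoise, directionNoise, gradErr, Finset.sum_sub_distrib,
      smul_sub]
    abel
  rw [h]
  rfl

theorem Run.gClient_sub_twoPoint (r : ℕ) (ω : Ω) (i : Fin m) :
    a.gClient p r ω (a.xhat p r ω) i -
      twoPoint a.η (p.f₂imp i) (a.xhat p r ω) (a.v i r ω) =
    ((n : ℝ) / (2 * a.η) * (a.penaltyErr p r i true ω - a.penaltyErr p r i false ω)) •
      (a.v i r ω : Vec n) := by
  have h1 : a.evalPt r ω (a.xhat p r ω) i true =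
      a.xhat p r ω + a.η • (a.v i r ω : Vec n) := by simp [evalPt, sgn]
  have h2 : a.evalPt r ω (a.xhat p r ω) i false =
      a.xhat p r ω - a.η • (a.v i r ω : Vec n) := by simp [evalPt, sgn, sub_eq_add_neg]
  rw [gClient, twoPoint, ← sub_smul, penaltyErr, penaltyErr, ← h1, ← h2]
  congr 1
  ring

theorem Run.norm_gradErr_sq_le (hm : 0 < m) (r : ℕ) (ω : Ω) :
    ‖a.gradErr p r ω‖ ^ 2 ≤ (1 / (m : ℝ)) * ∑ i, ((n : ℝ) / (2 * a.η)) ^ 2 *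
      (2 * (a.penaltyErr p r i true ω ^ 2 + a.penaltyErr p r i false ω ^ 2)) := by
  refine (norm_mean_sq_le hm _).trans ?_
  gcongr with i
  rw [gClient_sub_twoPoint, norm_smul, norm_eq_of_mem_sphere, mul_one, Real.norm_eq_abs, sq_abs,
    mul_pow]
  gcongr
  nlinarith [sq_nonneg (a.penaltyErr p r i true ω + a.penaltyErr p r i false ω)]

theorem Run.norm_directionNoise_le (hn : 0 < n) (hm : 0 < m) (hA : MainAssumption p c)
    (hη : 0 < a.η) (r : ℕ) (ω : Ω) : ‖a.directionNoise p r ω‖ ≤ 2 * (n * c.L₀imp) :=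
  norm_mean_le hm fun i => (norm_sub_le _ _).trans (by
    rw [two_mul]
    exact add_le_add (norm_twoPoint_le hη (hA.lip_imp i) _ _)
      (norm_sphereGrad_le hn hη (hA.lip_imp i) _))

variable [mΩ : MeasurableSpace Ω] {P : Measure Ω} [IsProbabilityMeasure P]

omit [IsProbabilityMeasure P] in
theorem Run.IsAdmissible.measurable_xhat (ha : a.IsAdmissible p P) (hp : p.WellPosed)
    (hA : MainAssumption p c) (r : ℕ) : Measurable (a.xhat p r) :=
  (Run.measurable_xhat hp hA r).mono (ha.history_le r) le_rfl

omit [IsProbabilityMeasure P] in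
theorem Run.IsAdmissible.measurable_penaltyErr (ha : a.IsAdmissible p P) (hp : p.WellPosed)
    (hA : MainAssumption p c) (r : ℕ) (i : Fin m) (b : Bool) :
    Measurable (a.penaltyErr p r i b) := by
  have hx := ha.measurable_xhat hp hA r
  have he := Run.measurable_evalPt (b := b) hx (ha.measurable_v i r)
  exact ((measurable_f₂ hA).comp (he.prodMk (Run.measurable_yOut hp hx (ha.measurable_v i r)
    (ha.measurable_y₀ i r b) fun t _ => ha.measurable_ζ i r b t))).sub
    ((hA.lip_imp i).continuous.measurable.comp he)

omit [IsProbabilityMeasure P] in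
theorem Run.IsAdmissible.penaltyErr_sq (ha : a.IsAdmissible p P) (hp : p.WellPosed)
    (hA : MainAssumption p c) {ε : Fin m → ℕ → ℝ≥0} (hε : a.HasInexactness p P ε)
    (r : ℕ) (i : Fin m) (b : Bool) :
    Integrable (fun ω => a.penaltyErr p r i b ω ^ 2) P ∧
      ∫ ω, a.penaltyErr p r i b ω ^ 2 ∂P ≤ (c.L₀y : ℝ) ^ 2 * ε i r := by
  have hm := ha.measurable_penaltyErr hp hA r i b
  have hle : ∫⁻ ω, ENNReal.ofReal (a.penaltyErr p r i b ω ^ 2) ∂P ≤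
      ((c.L₀y ^ 2 * ε i r : ℝ≥0) : ℝ≥0∞) := by
    have hpt : ∀ ω, ENNReal.ofReal (a.penaltyErr p r i b ω ^ 2) ≤ ((c.L₀y ^ 2 : ℝ≥0) : ℝ≥0∞) *
        ‖a.yOut p r ω (a.xhat p r ω) i b - p.ySol i (a.evalPt r ω (a.xhat p r ω) i b)‖ₑ ^ 2 := by
      intro ω
      have h := (hA.lip_y (a.evalPt r ω (a.xhat p r ω) i b)).edist_le_mul
        (a.yOut p r ω (a.xhat p r ω) i b) (p.ySol i (a.evalPt r ω (a.xhat p r ω) i b))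
      rw [edist_eq_enorm_sub, edist_eq_enorm_sub] at h
      rw [← sq_abs, ENNReal.ofReal_pow (abs_nonneg _), ← Real.norm_eq_abs, ofReal_norm,
        ENNReal.coe_pow, ← mul_pow]
      gcongr
      exact h
    refine (lintegral_mono hpt).trans ?_
    -- The lower-level solution map is not known to be measurable, so the constant is pulled out
    -- using only its finiteness.
    rw [lintegral_const_mul' _ _ ENNReal.coe_ne_top, ENNReal.coe_mul]
    gcongr
    exact hε i r b
  have h0 : 0 ≤ᵐ[P] fun ω => a.penaltyErr p r i b ω ^ 2 := ae_of_all _ fun ω => sq_nonneg _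
  have hm2 : AEStronglyMeasurable (fun ω => a.penaltyErr p r i b ω ^ 2) P :=
    (hm.pow_const 2).aestronglyMeasurable
  refine ⟨⟨hm2, ?_⟩, ?_⟩
  · rw [hasFiniteIntegral_iff_ofReal h0]
    exact hle.trans_lt ENNReal.coe_lt_top
  · rw [integral_eq_lintegral_of_nonneg_ae h0 hm2]
    simpa using ENNReal.toReal_mono ENNReal.coe_ne_top hle

omit [IsProbabilityMeasure P] in
theorem Run.IsAdmissible.measurable_gradErr (ha : a.IsAdmissible p P) (hp : p.WellPosed)
    (hA : MainAssumption p c) (r : ℕ) : Measurable (a.gradErr p r) := by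
  have h : ∀ i, Measurable fun ω => a.gClient p r ω (a.xhat p r ω) i -
      twoPoint a.η (p.f₂imp i) (a.xhat p r ω) (a.v i r ω) := fun i => by
    simp_rw [Run.gClient_sub_twoPoint]
    exact (((ha.measurable_penaltyErr hp hA r i true).sub
      (ha.measurable_penaltyErr hp hA r i false)).const_mul _).smul
      (measurable_subtype_coe.comp (ha.measurable_v i r))
  exact (Finset.measurable_fun_sum _ fun i _ => h i).fun_const_smul _

omit [IsProbabilityMeasure P] in
theorem Run.IsAdmissible.gradErr_sq (ha : a.IsAdmissible p P) (hp : p.WellPosed) (hm : 0 < m)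
    (hA : MainAssumption p c) {ε : Fin m → ℕ → ℝ≥0} (hε : a.HasInexactness p P ε) (r : ℕ) :
    Integrable (fun ω => ‖a.gradErr p r ω‖ ^ 2) P ∧
      ∫ ω, ‖a.gradErr p r ω‖ ^ 2 ∂P ≤
        4 * ((n : ℝ) / (2 * a.η)) ^ 2 * (c.L₀y : ℝ) ^ 2 * ((1 / (m : ℝ)) * ∑ i, (ε i r : ℝ)) := by
  have hsq := fun i b => ha.penaltyErr_sq hp hA hε r i b
  have hi : ∀ i, Integrable (fun ω => ((n : ℝ) / (2 * a.η)) ^ 2 *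
      (2 * (a.penaltyErr p r i true ω ^ 2 + a.penaltyErr p r i false ω ^ 2))) P := fun i =>
    (((hsq i true).1.add (hsq i false).1).const_mul 2).const_mul _
  have hI := (integrable_finsetSum Finset.univ fun i _ => hi i).const_mul (1 / (m : ℝ))
  refine ⟨hI.mono' ((ha.measurable_gradErr hp hA r).norm.pow_const 2).aestronglyMeasurable
    (ae_of_all _ fun ω => ?_), ?_⟩
  · rw [Real.norm_of_nonneg (sq_nonneg _)]
    exact Run.norm_gradErr_sq_le hm r ω
  · refine (integral_mono_of_nonneg (ae_of_all _ fun ω => sq_nonneg _) hI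
      (ae_of_all _ fun ω => Run.norm_gradErr_sq_le hm r ω)).trans ?_
    rw [integral_const_mul, integral_finsetSum _ fun i _ => hi i,
      mul_left_comm (4 * ((n : ℝ) / (2 * a.η)) ^ 2 * (c.L₀y : ℝ) ^ 2),
      Finset.mul_sum Finset.univ (fun i => (ε i r : ℝ))]
    refine mul_le_mul_of_nonneg_left (Finset.sum_le_sum fun i _ => ?_) (by positivity)
    rw [integral_const_mul, integral_const_mul, integral_add (hsq i true).1 (hsq i false).1]
    have h1 := (hsq i true).2
    have h2 := (hsq i false).2
    calc _ ≤ ((n : ℝ) / (2 * a.η)) ^ 2 *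
        (2 * ((c.L₀y : ℝ) ^ 2 * ε i r + (c.L₀y : ℝ) ^ 2 * ε i r)) := by gcongr
      _ = _ := by ring

theorem measurable_serverNoise (hp : p.WellPosed) (hA : MainAssumption p c) :
    Measurable fun q : Vec n × D => p.gradf₁s q.1 q.2 - gradient p.f₁ q.1 :=
  hp.measurable_gradf₁s.sub ((continuous_gradient_f₁ hA).measurable.comp measurable_fst)

theorem Run.IsAdmissible.serverNoise_sq (ha : a.IsAdmissible p P) (hp : p.WellPosed)
    (hA : MainAssumption p c) (r : ℕ) :
    Measurable (a.serverNoise p r) ∧ Integrable (fun ω => ‖a.serverNoise p r ω‖ ^ 2) P ∧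
      ∫ ω, ‖a.serverNoise p r ω‖ ^ 2 ∂P ≤ (c.σ : ℝ) ^ 2 := by
  have hm := measurable_serverNoise hp hA
  have hm' := hm.comp ((ha.measurable_xhat hp hA r).prodMk (ha.measurable_ξ r))
  simp only [Function.comp_def] at hm'
  change Measurable (a.serverNoise p r) at hm'
  have h := lintegral_le_of_indep (ha.history_le r) (Run.measurable_xhat hp hA r)
    (ha.measurable_ξ r) (ha.indep_ξ r) (hm.enorm.pow_const 2) (K := (c.σ : ℝ≥0∞) ^ 2)
    (by rw [ha.law_ξ r]; exact hA.var_f₁)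
  obtain ⟨h1, h2⟩ := integrable_norm_sq_of_lintegral_le hm' (k := c.σ ^ 2)
    (by rw [ENNReal.coe_pow]; exact h)
  exact ⟨hm', h1, by simpa using h2⟩

omit [IsProbabilityMeasure P] in
theorem Run.IsAdmissible.measurable_directionNoise_term (ha : a.IsAdmissible p P)
    (hp : p.WellPosed) (hn : 0 < n) (hA : MainAssumption p c) (hη : 0 < a.η) (r : ℕ) (i : Fin m) :
    Measurable fun ω => twoPoint a.η (p.f₂imp i) (a.xhat p r ω) (a.v i r ω) -
      sphereGrad a.η (p.f₂imp i) (a.xhat p r ω) :=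
  ((continuous_twoPoint (hA.lip_imp i).continuous).measurable.comp
    ((ha.measurable_xhat hp hA r).prodMk (ha.measurable_v i r))).sub
    ((continuous_sphereGrad hn hη (hA.lip_imp i)).measurable.comp (ha.measurable_xhat hp hA r))

omit [IsProbabilityMeasure P] in
theorem Run.IsAdmissible.measurable_directionNoise (ha : a.IsAdmissible p P)
    (hp : p.WellPosed) (hn : 0 < n) (hA : MainAssumption p c) (hη : 0 < a.η) (r : ℕ) :
    Measurable (a.directionNoise p r) :=
  (Finset.measurable_fun_sum _ fun i _ =>
    ha.measurable_directionNoise_term hp hn hA hη r i).fun_const_smul _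

theorem Run.IsAdmissible.setIntegral_inner_serverNoise (ha : a.IsAdmissible p P)
    (hp : p.WellPosed) (hn : 0 < n) (hA : MainAssumption p c) (hη : 0 < a.η) {r : ℕ} {A : Set Ω}
    (hAm : MeasurableSet[a.history r] A)
    (hg : IntegrableOn (fun ω => ‖p.gradfη a.η (a.xhat p r ω)‖ ^ 2) A P) :
    ∫ ω in A, inner ℝ (p.gradfη a.η (a.xhat p r ω)) (a.serverNoise p r ω) ∂P = 0 := by
  have hprob := hp.prob_server
  obtain ⟨hm, hi, -⟩ := ha.serverNoise_sq hp hA r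
  have hgm := (continuous_gradfη hn hA hη).measurable
  refine setIntegral_inner_eq_zero_of_indep (ha.history_le r) hAm (Run.measurable_xhat hp hA r)
    (ha.measurable_ξ r) (ha.indep_ξ r) hgm (measurable_serverNoise hp hA) ?_ ?_
    (integrable_inner_of_norm_sq (hgm.comp (ha.measurable_xhat hp hA r)) hm hg hi.integrableOn)
  · intro y
    simp only [ha.law_ξ r]
    exact (hA.integrable_gradf₁s y).sub (integrable_const _)
  · intro y
    simp only [ha.law_ξ r]
    rw [integral_sub (hA.integrable_gradf₁s y) (integrable_const _), hA.unbiased_f₁ y]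
    simp

/-- The inner product is linear in the noise, so clients are treated one at a time; independence of
the directions across clients plays no role. -/
theorem Run.IsAdmissible.setIntegral_inner_directionNoise (ha : a.IsAdmissible p P)
    (hp : p.WellPosed) (hn : 0 < n) (hA : MainAssumption p c) (hη : 0 < a.η) {r : ℕ} {A : Set Ω}
    (hAm : MeasurableSet[a.history r] A)
    (hg : IntegrableOn (fun ω => ‖p.gradfη a.η (a.xhat p r ω)‖ ^ 2) A P) :
    ∫ ω in A, inner ℝ (p.gradfη a.η (a.xhat p r ω)) (a.directionNoise p r ω) ∂P = 0 := by
  have hprob := isProbabilityMeasure_sphereUniform hn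
  have hgm := (continuous_gradfη hn hA hη).measurable
  have hint : ∀ i, IntegrableOn (fun ω => inner ℝ (p.gradfη a.η (a.xhat p r ω))
      (twoPoint a.η (p.f₂imp i) (a.xhat p r ω) (a.v i r ω) -
        sphereGrad a.η (p.f₂imp i) (a.xhat p r ω))) A P := fun i => by
    have hm := ha.measurable_directionNoise_term hp hn hA hη r i
    refine integrable_inner_of_norm_sq (hgm.comp (ha.measurable_xhat hp hA r)) hm hg ?_
    refine Integrable.of_bound (hm.norm.pow_const 2).aestronglyMeasurable
      ((n * c.L₀imp + n * c.L₀imp) ^ 2) (ae_of_all _ fun ω => ?_)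
    rw [Real.norm_of_nonneg (sq_nonneg _)]
    gcongr
    exact (norm_sub_le _ _).trans (add_le_add (norm_twoPoint_le hη (hA.lip_imp i) _ _)
      (norm_sphereGrad_le hn hη (hA.lip_imp i) _))
  have hzero : ∀ i, ∫ ω in A, inner ℝ (p.gradfη a.η (a.xhat p r ω))
      (twoPoint a.η (p.f₂imp i) (a.xhat p r ω) (a.v i r ω) -
        sphereGrad a.η (p.f₂imp i) (a.xhat p r ω)) ∂P = 0 := fun i => by
    have hti := integrable_twoPoint hn hη (hA.lip_imp i)
    refine setIntegral_inner_eq_zero_of_indep (ψ := fun q : Vec n × sphere (0 : Vec n) 1 =>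
      twoPoint a.η (p.f₂imp i) q.1 q.2 - sphereGrad a.η (p.f₂imp i) q.1)
      (ha.history_le r) hAm (Run.measurable_xhat hp hA r)
      (ha.measurable_v i r) (ha.indep_v i r) hgm ?_ ?_ ?_ (hint i)
    · exact (continuous_twoPoint (hA.lip_imp i).continuous).measurable.sub
        ((continuous_sphereGrad hn hη (hA.lip_imp i)).measurable.comp measurable_fst)
    · intro y
      simp only [ha.law_v i r]
      exact (hti y).sub (integrable_const _)
    · intro y
      simp only [ha.law_v i r]
      rw [integral_sub (hti y) (integrable_const _)]
      simp [sphereGrad]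
  simp only [Run.directionNoise, inner_smul_right, inner_sum]
  rw [integral_const_mul, integral_finsetSum _ fun i _ => hint i]
  simp [hzero]

/-- The expected decrease of the smoothed objective in one round, on an event known before it. -/
theorem Run.IsAdmissible.expected_descent (ha : a.IsAdmissible p P) (hp : p.WellPosed)
    (hn : 0 < n) (hm : 0 < m) (hA : MainAssumption p c) (hη : 0 < a.η)
    {ε : Fin m → ℕ → ℝ≥0} (hε : a.HasInexactness p P ε) {K : ℝ}
    (hK : K = c.L₁f₁ + n * c.L₀imp / a.η + 1) {b : ℝ} (hb : ∀ x, b ≤ p.fη a.η x) {r : ℕ}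
    (hγ : 0 ≤ a.γ r) (hγK : 16 * K * a.γ r ≤ 1) {A : Set Ω} (hAm : MeasurableSet[a.history r] A)
    (hV : IntegrableOn (fun ω => p.fη a.η (a.xhat p r ω) - b) A P) :
    IntegrableOn (fun ω => ‖p.gradfη a.η (a.xhat p r ω)‖ ^ 2) A P ∧
    IntegrableOn (fun ω => p.fη a.η (a.xhat p (r + 1) ω) - b) A P ∧
    ∫ ω in A, (p.fη a.η (a.xhat p (r + 1) ω) - b) ∂P +
        a.γ r / 2 * ∫ ω in A, ‖p.gradfη a.η (a.xhat p r ω)‖ ^ 2 ∂P ≤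
      ∫ ω in A, (p.fη a.η (a.xhat p r ω) - b) ∂P +
        (2 * (4 * ((n : ℝ) / (2 * a.η)) ^ 2 * (c.L₀y : ℝ) ^ 2) *
            (a.γ r * ((1 / (m : ℝ)) * ∑ i, (ε i r : ℝ))) +
          4 * K * ((c.σ : ℝ) ^ 2 + (2 * (n * c.L₀imp)) ^ 2) * a.γ r ^ 2) := by
  have hK0 : 0 < K := by
    rw [hK]
    positivity
  have hq : ∀ x y, p.fη a.η y ≤ p.fη a.η x + inner ℝ (p.gradfη a.η x) (y - x) +
      K * ‖y - x‖ ^ 2 := fun x y => hK ▸ fη_le_quadratic hn hm hA hη x y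
  have hgm : Measurable fun ω => p.gradfη a.η (a.xhat p r ω) :=
    (continuous_gradfη hn hA hη).measurable.comp (ha.measurable_xhat hp hA r)
  have hfc : Continuous (p.fη a.η) :=
    continuous_iff_continuousAt.2 fun x => (hasGradientAt_fη hn hA hη x).continuousAt
  -- A function bounded below controls its squared gradient, so integrability of the objective
  -- suffices.
  have hg : IntegrableOn (fun ω => ‖p.gradfη a.η (a.xhat p r ω)‖ ^ 2) A P := by
    refine (hV.const_mul (4 * K)).mono' (hgm.norm.pow_const 2).aestronglyMeasurable
      (ae_of_all _ fun ω => ?_)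
    rw [Real.norm_of_nonneg (sq_nonneg _)]
    exact norm_sq_le_of_quadratic_bound hK0 hb (hq _)
  obtain ⟨hNm, hNi, hNle⟩ := ha.serverNoise_sq hp hA r
  have hMm := ha.measurable_directionNoise hp hn hA hη r
  have hMle : ∀ ω, ‖a.directionNoise p r ω‖ ^ 2 ≤ (2 * (n * c.L₀imp)) ^ 2 := fun ω =>
    pow_le_pow_left₀ (norm_nonneg _) (Run.norm_directionNoise_le hn hm hA hη r ω) 2
  have hMi : Integrable (fun ω => ‖a.directionNoise p r ω‖ ^ 2) P :=
    Integrable.of_bound (hMm.norm.pow_const 2).aestronglyMeasurable ((2 * (n * c.L₀imp)) ^ 2)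
      (ae_of_all _ fun ω => by
        rw [Real.norm_of_nonneg (sq_nonneg _)]
        exact hMle ω)
  obtain ⟨hei, hele⟩ := ha.gradErr_sq hp hm hA hε r
  have hgN := integrable_inner_of_norm_sq (μ := P.restrict A) hgm hNm hg hNi.integrableOn
  have hgM := integrable_inner_of_norm_sq (μ := P.restrict A) hgm hMm hg hMi.integrableOn
  have hpt : ∀ ω, p.fη a.η (a.xhat p (r + 1) ω) - b ≤
      (p.fη a.η (a.xhat p r ω) - b) - a.γ r / 2 * ‖p.gradfη a.η (a.xhat p r ω)‖ ^ 2 -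
      a.γ r * (inner ℝ (p.gradfη a.η (a.xhat p r ω)) (a.serverNoise p r ω) +
        inner ℝ (p.gradfη a.η (a.xhat p r ω)) (a.directionNoise p r ω)) +
      2 * a.γ r * ‖a.gradErr p r ω‖ ^ 2 +
      4 * K * a.γ r ^ 2 * (‖a.serverNoise p r ω‖ ^ 2 + ‖a.directionNoise p r ω‖ ^ 2) := by
    intro ω
    have h := perturbed_descent (N := a.serverNoise p r ω) (M := a.directionNoise p r ω)
      (e := a.gradErr p r ω) hγ hγK hK0.le (hq (a.xhat p r ω))
    rw [← Run.xhat_succ] at h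
    linarith
  obtain ⟨hbi, hbeq⟩ := integral_descent_terms (μ := P.restrict A) (a.γ r / 2) (a.γ r)
    (2 * a.γ r) (4 * K * a.γ r ^ 2) hV hg hgN hgM hei.integrableOn hNi.integrableOn
    hMi.integrableOn
  have hV' : IntegrableOn (fun ω => p.fη a.η (a.xhat p (r + 1) ω) - b) A P := by
    refine hbi.mono' ((hfc.measurable.comp
      (ha.measurable_xhat hp hA (r + 1))).sub_const b).aestronglyMeasurable
      (ae_of_all _ fun ω => ?_)
    rw [Real.norm_of_nonneg (sub_nonneg.2 (hb _))]
    exact hpt ω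
  refine ⟨hg, hV', ?_⟩
  have hI := integral_mono hV' hbi hpt
  rw [hbeq, ha.setIntegral_inner_serverNoise hp hn hA hη hAm hg,
    ha.setIntegral_inner_directionNoise hp hn hA hη hAm hg] at hI
  have e1 : ∫ ω in A, ‖a.gradErr p r ω‖ ^ 2 ∂P ≤ _ :=
    (setIntegral_le_integral hei (ae_of_all _ fun ω => sq_nonneg _)).trans hele
  have e2 : ∫ ω in A, ‖a.serverNoise p r ω‖ ^ 2 ∂P ≤ (c.σ : ℝ) ^ 2 :=
    (setIntegral_le_integral hNi (ae_of_all _ fun ω => sq_nonneg _)).trans hNle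
  have e3 : ∫ ω in A, ‖a.directionNoise p r ω‖ ^ 2 ∂P ≤ (2 * (n * c.L₀imp)) ^ 2 := by
    refine (setIntegral_le_integral hMi (ae_of_all _ fun ω => sq_nonneg _)).trans ?_
    refine (integral_mono hMi (integrable_const _) hMle).trans ?_
    simp
  have e1' := mul_le_mul_of_nonneg_left e1 (by positivity : 0 ≤ 2 * a.γ r)
  have e4 := mul_le_mul_of_nonneg_left (add_le_add e2 e3)
    (by positivity : 0 ≤ 4 * K * a.γ r ^ 2)
  linarith

/-- On an event known before round `R`, the weighted squared gradients are summable. -/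
theorem Run.IsAdmissible.ae_summable_on (ha : a.IsAdmissible p P) (hp : p.WellPosed)
    (hn : 0 < n) (hm : 0 < m) (hA : MainAssumption p c) (hη : 0 < a.η)
    {ε : Fin m → ℕ → ℝ≥0} (hε : a.HasInexactness p P ε) {K : ℝ}
    (hK : K = c.L₁f₁ + n * c.L₀imp / a.η + 1) {b : ℝ} (hb : ∀ x, b ≤ p.fη a.η x)
    (hγ : ∀ r, 0 ≤ a.γ r) {R : ℕ} (hγK : ∀ r, R ≤ r → 16 * K * a.γ r ≤ 1)
    (hγ_sq : Summable fun r => a.γ r ^ 2)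
    (hγε : Summable fun r => a.γ r * ((1 / (m : ℝ)) * ∑ i, (ε i r : ℝ)))
    {A : Set Ω} (hAm : MeasurableSet[a.history R] A)
    (hV : IntegrableOn (fun ω => p.fη a.η (a.xhat p R ω) - b) A P) :
    ∀ᵐ ω ∂P.restrict A, Summable fun r => a.γ r * ‖p.gradfη a.η (a.xhat p r ω)‖ ^ 2 := by
  set β : ℕ → ℝ := fun r => 2 * (4 * ((n : ℝ) / (2 * a.η)) ^ 2 * (c.L₀y : ℝ) ^ 2) *
      (a.γ r * ((1 / (m : ℝ)) * ∑ i, (ε i r : ℝ))) +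
    4 * K * ((c.σ : ℝ) ^ 2 + (2 * (n * c.L₀imp)) ^ 2) * a.γ r ^ 2 with hβ
  have hK0 : 0 ≤ K := by
    rw [hK]
    positivity
  have hβ0 : ∀ r, 0 ≤ β r := fun r => by
    have := hγ r
    positivity
  have hβs : Summable β := (hγε.mul_left _).add (hγ_sq.mul_left _)
  have hAm' : ∀ k, MeasurableSet[a.history (R + k)] A := fun k =>
    Run.history_mono (Nat.le_add_right R k) _ hAm
  -- Integrability propagates from round to round: the next value is squeezed between `0` and an
  -- integrable bound.
  have hVk : ∀ k, IntegrableOn (fun ω => p.fη a.η (a.xhat p (R + k) ω) - b) A P := by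
    intro k
    induction k with
    | zero => exact hV
    | succ k ih =>
      exact (ha.expected_descent hp hn hm hA hη hε hK hb (hγ _)
        (hγK _ (Nat.le_add_right R k)) (hAm' k) ih).2.1
  have hstep := fun k => ha.expected_descent hp hn hm hA hη hε hK hb (hγ _)
        (hγK _ (Nat.le_add_right R k)) (hAm' k) (hVk k)
  set S : ℕ → ℝ := fun k => ∫ ω in A, (p.fη a.η (a.xhat p (R + k) ω) - b) ∂P
  set G : ℕ → ℝ := fun k => ∫ ω in A, ‖p.gradfη a.η (a.xhat p (R + k) ω)‖ ^ 2 ∂P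
  have hS0 : ∀ k, 0 ≤ S k := fun k => integral_nonneg fun ω => sub_nonneg.2 (hb _)
  have hG0 : ∀ k, 0 ≤ G k := fun k => integral_nonneg fun ω => sq_nonneg _
  have hle : ∀ k, S (k + 1) + a.γ (R + k) / 2 * G k ≤ S k + β (R + k) := fun k => (hstep k).2.2
  -- The expected descent telescopes; since `S N` is nonnegative, the weighted squared gradients
  -- have bounded partial sums.
  have hsum : ∀ N, S N + ∑ k ∈ Finset.range N, a.γ (R + k) / 2 * G k ≤
      S 0 + ∑ k ∈ Finset.range N, β (R + k) := by
    intro N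
    induction N with
    | zero => simp
    | succ N ih =>
      rw [Finset.sum_range_succ, Finset.sum_range_succ]
      linarith [hle N]
  have hβs' : Summable fun k => β (R + k) := by
    simpa [add_comm] using (summable_nat_add_iff R).2 hβs
  have hGs : Summable fun k => a.γ (R + k) / 2 * G k := by
    refine summable_of_sum_range_le (c := S 0 + ∑' k, β (R + k))
      (fun k => mul_nonneg (div_nonneg (hγ _) zero_le_two) (hG0 k)) fun N => ?_
    have := hβs'.sum_le_tsum (Finset.range N) fun k _ => hβ0 _
    linarith [hsum N, hS0 N]
  have hae := ae_summable_of_summable_integral (μ := P.restrict A)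
    (F := fun k ω => a.γ (R + k) * ‖p.gradfη a.η (a.xhat p (R + k) ω)‖ ^ 2)
    (fun k => (hstep k).1.const_mul _) (fun k ω => mul_nonneg (hγ _) (sq_nonneg _)) (by
      refine (hGs.mul_left 2).congr fun k => ?_
      rw [integral_const_mul]
      ring)
  filter_upwards [hae] with ω hω
  refine (summable_nat_add_iff R).1 ?_
  simpa [add_comm] using hω

end Descent

end ZOHFL

/-! ### Localization and conclusion -/

theorem theorem2 {n m : ℕ} (hn : 0 < n) (hm : 0 < m)
    {Ω : Type*} [MeasurableSpace Ω] (P : Measure Ω) [IsProbabilityMeasure P]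
    {D : Type*} [MeasurableSpace D]
    {Z : Fin m → Type*} [∀ i, MeasurableSpace (Z i)]
    (p : ZOHFL.Problem n m D Z) (hp : p.WellPosed)
    (c : ZOHFL.Constants m) (hA : ZOHFL.MainAssumption p c)
    (a : ZOHFL.Run n m Ω D Z) (ha : a.IsAdmissible p P)
    (hη : 0 < a.η)
    (hbdd : BddBelow (Set.range (p.fη a.η)))
    (hγ_nonneg : ∀ r, 0 ≤ a.γ r)
    (hγ_le : ∀ r, a.γ r * (4 * (a.η * c.L₁f₁ + c.L₀imp * Real.sqrt n)) ≤ a.η)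
    (hγ_nonsummable : ¬ Summable a.γ)
    (hγ_sq : Summable fun r => a.γ r ^ 2)
    (ε : Fin m → ℕ → ℝ≥0) (hε : a.HasInexactness p P ε)
    (hγε : Summable fun r => a.γ r * ((1 / (m : ℝ)) * ∑ i, (ε i r : ℝ))) :
    Differentiable ℝ (p.fη a.η) ∧
      ∀ᵐ ω ∂P, liminf (fun r => ‖gradient (p.fη a.η) (a.xhat p r ω)‖ₑ) atTop = 0 := by
  have hgrad := ZOHFL.hasGradientAt_fη hn hA hη
  have hdiff : Differentiable ℝ (p.fη a.η) := fun x => (hgrad x).differentiableAt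
  refine ⟨hdiff, ?_⟩
  obtain ⟨b, hb⟩ := hbdd
  replace hb : ∀ x, b ≤ p.fη a.η x := fun x => hb ⟨x, rfl⟩
  obtain ⟨K, hK⟩ : ∃ K : ℝ, K = c.L₁f₁ + n * c.L₀imp / a.η + 1 := ⟨_, rfl⟩
  have hK0 : 0 < K := by
    rw [hK]
    positivity
  obtain ⟨R, hR⟩ : ∃ R, ∀ r, R ≤ r → 16 * K * a.γ r ≤ 1 := by
    have h1 : Tendsto a.γ atTop (nhds 0) := by
      simpa [Function.comp_def, fun r => Real.sqrt_sq (hγ_nonneg r)] using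
        (Real.continuous_sqrt.tendsto 0).comp hγ_sq.tendsto_atTop_zero
    have h2 : Tendsto (fun r => 16 * K * a.γ r) atTop (nhds 0) := by
      simpa using h1.const_mul (16 * K)
    obtain ⟨R, hR⟩ := eventually_atTop.1 (h2.eventually_lt_const one_pos)
    exact ⟨R, fun r hr => (hR r hr).le⟩
  -- On each of these events the objective at round `R` is bounded, hence integrable; every outcome
  -- lies in one of them.
  let A : ℕ → Set Ω := fun k => {ω | p.fη a.η (a.xhat p R ω) - b ≤ k}
  have hfm : Measurable (p.fη a.η) := hdiff.continuous.measurable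
  have hVm : Measurable[a.history R] fun ω => p.fη a.η (a.xhat p R ω) - b :=
    (hfm.comp (ZOHFL.Run.measurable_xhat hp hA R)).sub_const b
  have hAm : ∀ k, MeasurableSet[a.history R] (A k) := fun k => hVm measurableSet_Iic
  have hVi : ∀ k, IntegrableOn (fun ω => p.fη a.η (a.xhat p R ω) - b) (A k) P := fun k => by
    refine IntegrableOn.of_bound (measure_lt_top _ _)
      (hVm.mono (ha.history_le R) le_rfl).aestronglyMeasurable k ?_
    refine (ae_restrict_iff' (ha.history_le R _ (hAm k))).2 (ae_of_all _ fun ω hω => ?_)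
    rw [Real.norm_of_nonneg (sub_nonneg.2 (hb _))]
    exact hω
  have hall : ∀ᵐ ω ∂P, ∀ k, ω ∈ A k →
      Summable fun r => a.γ r * ‖p.gradfη a.η (a.xhat p r ω)‖ ^ 2 :=
    ae_all_iff.2 fun k => (ae_restrict_iff' (ha.history_le R _ (hAm k))).1
      (ha.ae_summable_on hp hn hm hA hη hε hK hb hγ_nonneg hR hγ_sq hγε (hAm k) (hVi k))
  filter_upwards [hall] with ω hω
  obtain ⟨k, hk⟩ := exists_nat_ge (p.fη a.η (a.xhat p R ω) - b)
  simp_rw [fun x => (hgrad x).gradient]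
  exact ZOHFL.liminf_enorm_eq_zero hγ_nonneg hγ_nonsummable (hω k hk)
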